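/- Let $n\ge 3$, $0<\alpha<1$, and let $\Omega\subset\mathbb R^n$ be an exterior domain: open and connected, with bounded complement, with $0\notin\overline\Omega$, and with boundary $\Gamma=\partial\Omega$ of class $C^{2,\alpha}$, $\Omega$ lying locally on one side of $\Gamma$. Let $\nu$ be the outward unit normal and $dS$ the surface measure on $\Gamma$. **Gas and force.** Let $p\in C^2(0,\infty)$ with $p'(\rho)>0$ and $2p'(\rho)+\rho p''(\rho)>0$ for $\rho>0$, and put $h(\rho)=\int_1^\rho \frac{p'(\tau)}{\tau}d\tau$, $H(\rho)=\frac{p'(\rho)}2+h(\rho)$, $J=\bigl(\lim_{\rho\to0^+}H(\rho),\lim_{\rho\to\infty}h(\rho)\bigr)$, $\rho(s)=h^{-1}(-s/2)$, and $q_{cr}(w)=\bigl(2w-2h(H^{-1}(w))\bigr)^{1/2}$ for $w\in J$. Let $\psi$ be continuous on $\overline\Omega$ and bounded, with values in $J$ on $\overline\Omega$, with weak gradient $\nabla\psi$ in $\Omega$ such that $\partial_1\psi\in L^{\frac{2n}{n+2}}(\Omega)$ and $|x|^\beta\nabla\psi\in L^s(\Omega)$ for some $s>n$ and $\beta>1-\frac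 ns$. **Cut-off.** Let $0<\theta<\frac12$ and $c>0$. A cut-off density with ellipticity constant $c$ is a $C^1$ function $\tilde\rho(v,w)$ on $[0,\infty)\times J$ such that, for $w\in J$ and $\lambda\ge 0$, $$\tilde\rho(\lambda^2,w)=\begin{cases}\rho(\lambda^2-2w), & \lambda\le(1-2\theta)\,q_{cr}(w),\\ \sup_{x\in\Omega}\rho\bigl((1-\theta)^2q_{cr}^2(\psi(x))-2\psi(x)\bigr), & \lambda\ge(1-\theta)\,q_{cr}(w),\end{cases}$$ and such that the cut-off problem is uniformly elliptic: for all $x\in\Omega$ and $P,\xi\in\mathbb R^n$, $$c|\xi|^2\le\tilde\rho(|P|^2,\psi(x))|\xi|^2+2\tilde\rho_v(|P|^2,\psi(x))(P\cdot\xi)^2\le c^{-1}|\xi|^2,\qquad |\tilde\rho_w(|P|^2,\psi(x))|\,|P|\le c^{-1}.$$ **Energy space and functional.** Let $\mathcal V$ be the completion of $\mathcal V_0=\{\tilde\varphi|_\Omega:\tilde\varphi\in C_0^\infty(\mathbb R^n)\}$ under the norm $\bigl(\int_\Omega|\nabla\varphi|^2dx\bigr)^{1/2}$, realized as a space of functions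 in $L^{\frac{2n}{n-2}}(\Omega)$ which have a gradient in $L^2(\Omega)$ and a trace in $L^1(\Gamma)$, these being the limits of the functions, gradients and boundary values of elements of $\mathcal V_0$. Put $G(\Lambda,w)=\frac12\int_0^\Lambda\tilde\rho(v,w)\,dv$. For $q_\infty\ge0$, $\varepsilon\in\{1,-1\}$, $\varphi\in\mathcal V$ and $\phi=\varphi+q_\infty x_1$ let $$\begin{aligned}I_\varepsilon(\varphi,q_\infty)={}&\int_\Omega\Bigl[G(|\nabla\phi|^2,\psi)-G(q_\infty^2,\psi)-2G_v(q_\infty^2,\psi)\,q_\infty(\partial_1\phi-q_\infty)\Bigr]dx\\&+\varepsilon\Bigl(\int_\Omega 2G_{vw}(q_\infty^2,\psi)\,q_\infty\,\partial_1\psi\,\varphi\,dx-\int_\Gamma 2G_v(q_\infty^2,\psi)\,q_\infty\,\varphi\,\nu_1\,dS\Bigr).\end{aligned}$$ (The Euler–Lagrange equation of $I_{-1}$ is the cut-off problem $\operatorname{div}(\tilde\rho(|\nabla\phi|^2,\psi)\nabla\phi)=0$ in $\Omega$, $\partial\phi/\partial\nu=0$ on $\Gamma$.) **Theorem.** There is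 a constant $C$, depending only on $q_\infty$, $\psi$, $\Omega$ and the ellipticity constant $c$, such that for every such $p$, $\theta$ and $\tilde\rho$ and both signs $\varepsilon$, the three integrands of $I_\varepsilon(\varphi,q_\infty)$ are integrable for every $\varphi\in\mathcal V$, the functional $I_\varepsilon(\cdot,q_\infty)$ has a unique minimizer $\bar\varphi$ in $\mathcal V$, and $$\int_\Omega|\nabla\bar\varphi|^2\,dx\le C.$$ -/

import Mathlib

open MeasureTheory Set Filter Topology
open scoped ENNReal NNReal ContDiff

noncomputable section

/-! ### Domains -/

/-- `ν` is the outward unit normal of `Ω` at the boundary point `x`: every direction in the open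
half-space opposite to `ν` enters `Ω`, every direction in the open half-space of `ν` leaves it.
At a boundary point of a `C¹` domain exactly one vector has this property. -/
def IsOuterUnitNormal {n : ℕ} (Ω : Set (EuclideanSpace ℝ (Fin n)))
    (x ν : EuclideanSpace ℝ (Fin n)) : Prop :=
  ‖ν‖ = 1 ∧
  (∀ v, inner ℝ v ν < 0 → ∀ᶠ t : ℝ in 𝓝[>] 0, x + t • v ∈ Ω) ∧
  (∀ v, 0 < inner ℝ v ν → ∀ᶠ t : ℝ in 𝓝[>] 0, x + t • v ∉ Ω)

/-- The outward unit normal of `Ω` at `x`. -/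
def outerNormal {n : ℕ} (Ω : Set (EuclideanSpace ℝ (Fin n)))
    (x : EuclideanSpace ℝ (Fin n)) : EuclideanSpace ℝ (Fin n) :=
  Classical.epsilon (IsOuterUnitNormal Ω x)

/-- The boundary of `Ω` is of class `C^{2,α}`, with `Ω` locally on one side of it: near each
boundary point, `Ω` is the region below the graph of a `C^{2,α}` function `γ` over a hyperplane
`N^⊥` (`γ` is only evaluated at the orthogonal projection of `x` to `N^⊥`). -/
def HasC2HolderBoundary {n : ℕ} (α : ℝ≥0) (Ω : Set (EuclideanSpace ℝ (Fin n))) : Prop :=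
  ∀ x₀ ∈ frontier Ω, ∃ (N : EuclideanSpace ℝ (Fin n)) (γ : EuclideanSpace ℝ (Fin n) → ℝ) (r : ℝ),
    ‖N‖ = 1 ∧ 0 < r ∧ ContDiff ℝ 2 γ ∧ (∃ K, HolderWith K α (fderiv ℝ (fderiv ℝ γ))) ∧
    ∀ x ∈ Metric.ball x₀ r, x ∈ Ω ↔ inner ℝ N x < γ (x - inner ℝ N x • N)

/-- Exterior domains: the connected open region outside a bounded obstacle which contains the
origin in its interior, with compact boundary of class `C^{2,α}`. -/
structure IsExteriorDomain {n : ℕ} (α : ℝ≥0) (Ω : Set (EuclideanSpace ℝ (Fin n))) : Prop where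
  isOpen : IsOpen Ω
  isConnected : IsConnected Ω
  isBounded_compl : Bornology.IsBounded Ωᶜ
  zero_notMem : (0 : EuclideanSpace ℝ (Fin n)) ∉ closure Ω
  boundary : HasC2HolderBoundary α Ω

/-- Surface measure on the boundary of `Ω`: the `(n-1)`-dimensional Hausdorff measure, normalized
to agree with Lebesgue measure on hyperplanes. -/
def surfaceMeasure {n : ℕ} (Ω : Set (EuclideanSpace ℝ (Fin n))) :
    Measure (EuclideanSpace ℝ (Fin n)) :=
  (Measure.euclideanHausdorffMeasure (n - 1)).restrict (frontier Ω)

/-- `g` is the weak gradient of `f` in `Ω`. -/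
def IsWeakGradient {n : ℕ} (Ω : Set (EuclideanSpace ℝ (Fin n)))
    (f : EuclideanSpace ℝ (Fin n) → ℝ) (g : EuclideanSpace ℝ (Fin n) → EuclideanSpace ℝ (Fin n)) :
    Prop :=
  LocallyIntegrableOn g Ω ∧
  ∀ η : EuclideanSpace ℝ (Fin n) → ℝ, ContDiff ℝ ∞ η → HasCompactSupport η → tsupport η ⊆ Ω →
    ∀ v, ∫ x in Ω, f x * fderiv ℝ η x v = - ∫ x in Ω, inner ℝ (g x) v * η x

/-! ### The gas -/

/-- Pressure laws `p(ρ)`, `ρ > 0`, with `p' > 0` and `2 p' + ρ p'' > 0`. -/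
structure IsPressureLaw (p : ℝ → ℝ) : Prop where
  contDiffOn : ContDiffOn ℝ 2 p (Ioi 0)
  deriv_pos : ∀ ρ, 0 < ρ → 0 < deriv p ρ
  convexity : ∀ ρ, 0 < ρ → 0 < 2 * deriv p ρ + ρ * deriv (deriv p) ρ

/-- `h(ρ) = ∫₁^ρ p'(τ)/τ dτ`. -/
def enthalpy (p : ℝ → ℝ) (ρ : ℝ) : ℝ := ∫ τ in (1 : ℝ)..ρ, deriv p τ / τ

/-- `H(ρ) = p'(ρ)/2 + h(ρ)`. -/
def sonicH (p : ℝ → ℝ) (ρ : ℝ) : ℝ := deriv p ρ / 2 + enthalpy p ρ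

/-- The interval of the `w` with `lim_{ρ→0+} H(ρ) < w < lim_{ρ→+∞} h(ρ)`. Both functions are
strictly increasing on `(0,∞)`, so the first limit is the infimum of `H` and the second one the
supremum of `h`, neither being attained. -/
def admissibleRange (p : ℝ → ℝ) : Set ℝ :=
  {w | (∃ ρ, 0 < ρ ∧ sonicH p ρ < w) ∧ (∃ ρ, 0 < ρ ∧ w < enthalpy p ρ)}

/-- The density `ρ(s) = h⁻¹(-s/2)`, as a function of `s = |u|² - 2ψ`. -/
def density (p : ℝ → ℝ) (s : ℝ) : ℝ := Function.invFunOn (enthalpy p) (Ioi 0) (-s / 2)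

/-- The critical speed `q_cr(w) = (2w - 2h(H⁻¹(w)))^{1/2}`. -/
def criticalSpeed (p : ℝ → ℝ) (w : ℝ) : ℝ :=
  Real.sqrt (2 * w - 2 * enthalpy p (Function.invFunOn (sonicH p) (Ioi 0) w))

/-- `R(v, w)` is an admissible cut-off `ρ̃(v, w)` of the density for the force potential `ψ`, with
parameter `θ` and ellipticity constant `c`. It is a `C¹` function that is the true density
at speeds up to `(1-2θ) q_cr(w)` and a constant at speeds from `(1-θ) q_cr(w)` on, and the
connection between these is such that the cut-off equation is uniformly elliptic. -/
structure IsCutoffDensity {n : ℕ} (p : ℝ → ℝ) (Ω : Set (EuclideanSpace ℝ (Fin n)))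
    (ψ : EuclideanSpace ℝ (Fin n) → ℝ) (θ c : ℝ) (R : ℝ → ℝ → ℝ) : Prop where
  contDiffOn : ContDiffOn ℝ 1 (fun z : ℝ × ℝ => R z.1 z.2) (Ici 0 ×ˢ admissibleRange p)
  eq_density : ∀ w ∈ admissibleRange p, ∀ q, 0 ≤ q → q ≤ (1 - 2 * θ) * criticalSpeed p w →
    R (q ^ 2) w = density p (q ^ 2 - 2 * w)
  eq_const : ∀ w ∈ admissibleRange p, ∀ q, (1 - θ) * criticalSpeed p w ≤ q →
    R (q ^ 2) w =
      sSup ((fun x => density p ((1 - θ) ^ 2 * criticalSpeed p (ψ x) ^ 2 - 2 * ψ x)) '' Ω)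
  elliptic_lower : ∀ x ∈ Ω, ∀ P ξ : EuclideanSpace ℝ (Fin n),
    c * ‖ξ‖ ^ 2 ≤ R (‖P‖ ^ 2) (ψ x) * ‖ξ‖ ^ 2
      + 2 * deriv (fun v => R v (ψ x)) (‖P‖ ^ 2) * inner ℝ P ξ ^ 2
  elliptic_upper : ∀ x ∈ Ω, ∀ P ξ : EuclideanSpace ℝ (Fin n),
    R (‖P‖ ^ 2) (ψ x) * ‖ξ‖ ^ 2
      + 2 * deriv (fun v => R v (ψ x)) (‖P‖ ^ 2) * inner ℝ P ξ ^ 2 ≤ c⁻¹ * ‖ξ‖ ^ 2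
  lower_order : ∀ x ∈ Ω, ∀ P : EuclideanSpace ℝ (Fin n),
    |deriv (fun w => R (‖P‖ ^ 2) w) (ψ x)| * ‖P‖ ≤ c⁻¹

/-- `G(Λ, w) = ½ ∫₀^Λ ρ̃(v, w) dv`. -/
def potentialG (R : ℝ → ℝ → ℝ) (Λ w : ℝ) : ℝ := 1 / 2 * ∫ v in (0 : ℝ)..Λ, R v w

/-- `G_v`, the derivative of `G` in its first variable. -/
def potentialGv (R : ℝ → ℝ → ℝ) (Λ w : ℝ) : ℝ := deriv (fun v => potentialG R v w) Λ

/-- `G_{vw}`, the mixed second derivative of `G`. -/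
def potentialGvw (R : ℝ → ℝ → ℝ) (Λ w : ℝ) : ℝ := deriv (fun w' => potentialGv R Λ w') w

/-! ### The energy space -/

/-- The Sobolev exponent `2n/(n-2)`. -/
def sobolevExponent (n : ℕ) : ℝ≥0∞ := ENNReal.ofReal (2 * n / (n - 2))

instance sobolevExponent_fact {n : ℕ} [hn : Fact (3 ≤ n)] : Fact (1 ≤ sobolevExponent n) := by
  refine ⟨?_⟩
  have h3 : (3 : ℝ) ≤ n := by exact_mod_cast hn.out
  rw [sobolevExponent, ← ENNReal.ofReal_one]
  apply ENNReal.ofReal_le_ofReal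
  rw [le_div_iff₀ (by linarith)]
  linarith

instance neZero_of_three_le {n : ℕ} [hn : Fact (3 ≤ n)] : NeZero n :=
  ⟨by have := hn.out; omega⟩

/-- Triples consisting of a function on `Ω`, a vector field on `Ω` and a function on the boundary
of `Ω`, in `L^{2n/(n-2)}(Ω) × L²(Ω; ℝⁿ) × L¹(∂Ω)`. -/
abbrev EnergyTriple {n : ℕ} (Ω : Set (EuclideanSpace ℝ (Fin n))) : Type :=
  Lp ℝ (sobolevExponent n) (volume.restrict Ω) ×
    Lp (EuclideanSpace ℝ (Fin n)) 2 (volume.restrict Ω) × Lp ℝ 1 (surfaceMeasure Ω)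

/-- `𝒱₀`: the restrictions to `Ω` of functions `φ ∈ C₀^∞(ℝⁿ)`, each recorded together with its
gradient in `Ω` and its boundary values, as the triple `(φ, ∇φ, φ|_{∂Ω})`. -/
def smoothEnergySpace {n : ℕ} [Fact (3 ≤ n)] (Ω : Set (EuclideanSpace ℝ (Fin n))) :
    Submodule ℝ (EnergyTriple Ω) where
  carrier := {z | ∃ φ : EuclideanSpace ℝ (Fin n) → ℝ, ContDiff ℝ ∞ φ ∧ HasCompactSupport φ ∧
    z.1 =ᵐ[volume.restrict Ω] φ ∧ z.2.1 =ᵐ[volume.restrict Ω] gradient φ ∧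
    z.2.2 =ᵐ[surfaceMeasure Ω] φ}
  zero_mem' := by
    refine ⟨0, contDiff_const, HasCompactSupport.zero, Lp.coeFn_zero _ _ _, ?_,
      Lp.coeFn_zero _ _ _⟩
    filter_upwards [Lp.coeFn_zero (EuclideanSpace ℝ (Fin n)) 2 (volume.restrict Ω)] with x hx
    have h0 : gradient (0 : EuclideanSpace ℝ (Fin n) → ℝ) x = 0 := by
      simp [gradient]
    rw [h0]
    exact hx
  add_mem' := by
    rintro a b ⟨φ, h1, h2, h3, h4, h5⟩ ⟨χ, k1, k2, k3, k4, k5⟩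
    refine ⟨φ + χ, h1.add k1, h2.add k2, ?_, ?_, ?_⟩
    · exact (Lp.coeFn_add a.1 b.1).trans (h3.add k3)
    · refine (Lp.coeFn_add a.2.1 b.2.1).trans ((h4.add k4).trans (Eventually.of_forall ?_))
      intro x
      have hφ : DifferentiableAt ℝ φ x := h1.contDiffAt.differentiableAt (by simp)
      have hχ : DifferentiableAt ℝ χ x := k1.contDiffAt.differentiableAt (by simp)
      simp [gradient, fderiv_add hφ hχ]
    · exact (Lp.coeFn_add a.2.2 b.2.2).trans (h5.add k5)
  smul_mem' := by
    rintro s a ⟨φ, h1, h2, h3, h4, h5⟩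
    refine ⟨s • φ, contDiff_const.smul h1, h2.smul_left (f := fun _ => s), ?_, ?_, ?_⟩
    · exact (Lp.coeFn_smul s a.1).trans (h3.const_smul s)
    · refine (Lp.coeFn_smul s a.2.1).trans ((h4.const_smul s).trans (Eventually.of_forall ?_))
      intro x
      have hφ : DifferentiableAt ℝ φ x := h1.contDiffAt.differentiableAt (by simp)
      simp [gradient, fderiv_const_smul hφ]
    · exact (Lp.coeFn_smul s a.2.2).trans (h5.const_smul s)

/-- The homogeneous energy space `𝒱`, the completion of `𝒱₀` for the norm `‖∇φ‖_{L²(Ω)}`,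
realized as a space of functions. On `𝒱₀` this norm controls `‖φ‖_{L^{2n/(n-2)}(Ω)}` and
`‖φ‖_{L¹(∂Ω)}` when `Ω` is an exterior domain and `n ≥ 3`; so the completion is the closure of
`𝒱₀` in `L^{2n/(n-2)}(Ω) × L²(Ω; ℝⁿ) × L¹(∂Ω)`, and an element of it carries its values in `Ω`,
its gradient, and its trace on the boundary. -/
def energySpace {n : ℕ} [Fact (3 ≤ n)] (Ω : Set (EuclideanSpace ℝ (Fin n))) :
    Submodule ℝ (EnergyTriple Ω) :=
  (smoothEnergySpace Ω).topologicalClosure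

/-- The values of `ϕ ∈ 𝒱` in `Ω`. -/
def energyVal {n : ℕ} [Fact (3 ≤ n)] {Ω : Set (EuclideanSpace ℝ (Fin n))}
    (ϕ : energySpace Ω) : EuclideanSpace ℝ (Fin n) → ℝ := ϕ.1.1

/-- The gradient of `ϕ ∈ 𝒱`. -/
def energyGrad {n : ℕ} [Fact (3 ≤ n)] {Ω : Set (EuclideanSpace ℝ (Fin n))}
    (ϕ : energySpace Ω) : EuclideanSpace ℝ (Fin n) → EuclideanSpace ℝ (Fin n) := ϕ.1.2.1

/-- The trace of `ϕ ∈ 𝒱` on the boundary of `Ω`. -/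
def energyTrace {n : ℕ} [Fact (3 ≤ n)] {Ω : Set (EuclideanSpace ℝ (Fin n))}
    (ϕ : energySpace Ω) : EuclideanSpace ℝ (Fin n) → ℝ := ϕ.1.2.2

/-! ### The functional -/

/-- The first volume density of the functional, at `φ = ϕ + q x₁` with `ϕ ∈ 𝒱`:
`G(|∇φ|², ψ) - G(q², ψ) - 2 G_v(q², ψ) q (∂₁φ - q)`, where `∇φ = ∇ϕ + q e₁`. -/
def energyDensity {n : ℕ} [Fact (3 ≤ n)] {Ω : Set (EuclideanSpace ℝ (Fin n))}
    (R : ℝ → ℝ → ℝ) (ψ : EuclideanSpace ℝ (Fin n) → ℝ) (q : ℝ) (ϕ : energySpace Ω)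
    (x : EuclideanSpace ℝ (Fin n)) : ℝ :=
  potentialG R (‖energyGrad ϕ x + q • EuclideanSpace.single (0 : Fin n) (1 : ℝ)‖ ^ 2) (ψ x)
    - potentialG R (q ^ 2) (ψ x)
    - 2 * potentialGv R (q ^ 2) (ψ x) * q *
      ((energyGrad ϕ x + q • EuclideanSpace.single (0 : Fin n) (1 : ℝ)) 0 - q)

/-- The second volume density: `2 G_{vw}(q², ψ) q ∂₁ψ (φ - q x₁)`. Here `g` is the gradient
of `ψ`, and `φ - q x₁ = ϕ`. -/
def forceDensity {n : ℕ} [Fact (3 ≤ n)] {Ω : Set (EuclideanSpace ℝ (Fin n))}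
    (R : ℝ → ℝ → ℝ) (ψ : EuclideanSpace ℝ (Fin n) → ℝ)
    (g : EuclideanSpace ℝ (Fin n) → EuclideanSpace ℝ (Fin n)) (q : ℝ) (ϕ : energySpace Ω)
    (x : EuclideanSpace ℝ (Fin n)) : ℝ :=
  2 * potentialGvw R (q ^ 2) (ψ x) * q * g x 0 * energyVal ϕ x

/-- The surface density: `2 G_v(q², ψ) q (φ - q x₁) ν₁`. -/
def surfaceDensity {n : ℕ} [Fact (3 ≤ n)] {Ω : Set (EuclideanSpace ℝ (Fin n))}
    (R : ℝ → ℝ → ℝ) (ψ : EuclideanSpace ℝ (Fin n) → ℝ) (q : ℝ) (ϕ : energySpace Ω)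
    (x : EuclideanSpace ℝ (Fin n)) : ℝ :=
  2 * potentialGv R (q ^ 2) (ψ x) * q * energyTrace ϕ x * outerNormal Ω x 0

/-- The functional `I(ϕ, q)`, with the sign `ε` in front of its force and surface terms. With `ν`
outward, the terms of `I` that are linear in `ϕ` cancel on `𝒱₀` by the divergence theorem exactly
when `ε = -1`; then the Euler–Lagrange equation is the cut-off potential equation. -/
def energyFunctional {n : ℕ} [Fact (3 ≤ n)] {Ω : Set (EuclideanSpace ℝ (Fin n))}
    (ε : ℝ) (R : ℝ → ℝ → ℝ) (ψ : EuclideanSpace ℝ (Fin n) → ℝ)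
    (g : EuclideanSpace ℝ (Fin n) → EuclideanSpace ℝ (Fin n)) (q : ℝ) (ϕ : energySpace Ω) : ℝ :=
  (∫ x in Ω, energyDensity R ψ q ϕ x)
    + ε * ((∫ x in Ω, forceDensity R ψ g q ϕ x)
      - ∫ x, surfaceDensity R ψ q ϕ x ∂(surfaceMeasure Ω))

end

/-!
The functional is, up to a bounded linear term, an integral of uniformly convex functions of the
gradient, so the theorem is the direct method once the linear term is bounded in the energy norm.

*Convexity.* By the ellipticity conditions, `P ↦ G(|P|², w)` has second derivatives between `c` and
`c⁻¹`, and the first density of the functional is the excess of this function over its tangent plane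
at `q e₁` (`energyDensity_eq`). It therefore lies between `c/2 |∇ϕ|²` and `c⁻¹/2 |∇ϕ|²`, and it is
uniformly convex in `∇ϕ` (`radialExcess_lower_bound`, `radialExcess_upper_bound`,
`radialExcess_convex`).

*Linear terms.* Their coefficients are bounded by `c⁻¹` and `c⁻¹ q` (`force_term`, `surface_term`).
What is needed is that `‖∇ϕ‖_{L²(Ω)}` controls both `‖ϕ‖_{L^{2n/(n-2)}(Ω)}` and `‖ϕ‖_{L¹(∂Ω)}`
(`exists_norm_le_mul_norm_grad`). This is proved for `C¹` functions with compact support in the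
whole space, in three stages, and passes to the closure.
* Square integrals over bounded parts of `Ω` are controlled by the energy. Far away this follows by
  integrating along rays, as `n ≥ 3` (`energyDominated_annulus`). The property propagates along
  segments in `Ω` by translation, hence to all points of the connected set `Ω`
  (`energyDominated_ball_of_mem`), and by one more translation along the graph direction to the
  boundary (`energyDominated_ball_of_mem_frontier`).
* With this, cut-off functions localize the Sobolev inequality. In the interior and near infinity it
  is the Gagliardo–Nirenberg–Sobolev inequality on the whole space; near the boundary it is applied
  after a `C¹` extension by reflection (`exists_eLpNorm_sq_le_lintegral_fderiv_below_graph`).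
* The trace is estimated by integrating along short segments entering `Ω`, the surface measure on a
  graph being dominated by the image of the measure on the hyperplane
  (`energyDominated_trace_ball`).

Consequently the functional is continuous, uniformly convex and bounded below on the Banach space
`𝒱`, which gives the unique minimizer (`exists_unique_minimizer_of_uniformly_convex`). Comparison
with `ϕ = 0` gives `c/2 ‖∇ϕ‖² ≤ L ‖∇ϕ‖`, where `L` depends only on `c`, `q`, `∂₁ψ` and `Ω`.
-/

noncomputable section

section EnergyControl

/-! ### Integral inequalities -/

lemma ENNReal.add_sq_le_two_mul (a b : ℝ≥0∞) : (a + b) ^ 2 ≤ 2 * (a ^ 2 + b ^ 2) := by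
  have h := ENNReal.rpow_add_le_mul_rpow_add_rpow a b (p := 2) (by norm_num)
  norm_num at h
  exact_mod_cast h

lemma lintegral_mul_sq_le {X : Type*} [MeasurableSpace X] (μ : Measure X) {f g : X → ℝ≥0∞}
    (hf : AEMeasurable f μ) (hg : AEMeasurable g μ) :
    (∫⁻ x, f x * g x ∂μ) ^ 2 ≤ (∫⁻ x, f x ^ 2 ∂μ) * ∫⁻ x, g x ^ 2 ∂μ := by
  have h := ENNReal.lintegral_mul_le_Lp_mul_Lq μ Real.HolderConjugate.two_two hf hg
  have key : ∀ a b : ℝ≥0∞, (a ^ (1 / (2 : ℝ)) * b ^ (1 / (2 : ℝ))) ^ 2 = a * b := by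
    intro a b
    rw [mul_pow, ← ENNReal.rpow_natCast, ← ENNReal.rpow_natCast, ← ENNReal.rpow_mul,
      ← ENNReal.rpow_mul]
    norm_num
  refine (pow_le_pow_left' h 2).trans ?_
  simp only [ENNReal.rpow_two, key, le_refl]

lemma lintegral_sq_le_measure_mul {X : Type*} [MeasurableSpace X] (μ : Measure X) {f : X → ℝ≥0∞}
    (hf : AEMeasurable f μ) :
    (∫⁻ x, f x ∂μ) ^ 2 ≤ μ univ * ∫⁻ x, f x ^ 2 ∂μ := by
  simpa using lintegral_mul_sq_le μ (f := fun _ => 1) aemeasurable_const hf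

section Calculus

variable {E : Type*} [NormedAddCommGroup E] [NormedSpace ℝ E]

lemma enorm_sub_le_lintegral_fderiv {u : E → ℝ} (hu : ContDiff ℝ 1 u) (x v : E) {a b : ℝ}
    (hab : a ≤ b) :
    ‖u (x + b • v) - u (x + a • v)‖ₑ ≤ ‖v‖ₑ * ∫⁻ t in Ioc a b, ‖fderiv ℝ u (x + t • v)‖ₑ := by
  have hd : ∀ t : ℝ, HasDerivAt (fun t : ℝ => u (x + t • v)) (fderiv ℝ u (x + t • v) v) t := by
    intro t
    have h1 : HasDerivAt (fun t : ℝ => x + t • v) v t := by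
      simpa using ((hasDerivAt_id t).smul_const v).const_add x
    exact ((hu.differentiable one_ne_zero) (x + t • v)).hasFDerivAt.comp_hasDerivAt t h1
  have hc : Continuous fun t : ℝ => fderiv ℝ u (x + t • v) :=
    (hu.continuous_fderiv one_ne_zero).comp (by fun_prop)
  have hc' : Continuous fun t : ℝ => fderiv ℝ u (x + t • v) v := hc.clm_apply continuous_const
  have hint := intervalIntegral.integral_eq_sub_of_hasDerivAt (fun t _ => hd t)
    (hc'.intervalIntegrable a b)
  rw [← hint, intervalIntegral.integral_of_le hab]
  refine (enorm_integral_le_lintegral_enorm _).trans ?_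
  rw [← lintegral_const_mul' _ _ (by simp)]
  refine lintegral_mono fun t => ?_
  rw [mul_comm]
  exact ContinuousLinearMap.le_opENorm _ _

end Calculus

/-! ### Quantities controlled by the Dirichlet energy -/

variable {E : Type*} [NormedAddCommGroup E] [InnerProductSpace ℝ E] [FiniteDimensional ℝ E]
  [MeasurableSpace E] [BorelSpace E]

/-- The Dirichlet energy `∫_Ω |∇u|²` of `u`, as an extended nonnegative number. -/
def dirichletEnergy (Ω : Set E) (u : E → ℝ) : ℝ≥0∞ := ∫⁻ x in Ω, ‖fderiv ℝ u x‖ₑ ^ 2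

/-- The quantity `F` is bounded by a constant multiple of the Dirichlet energy in `Ω`, on the
compactly supported `C¹` functions on the whole space. -/
def EnergyDominated (Ω : Set E) (F : (E → ℝ) → ℝ≥0∞) : Prop :=
  ∃ C : ℝ≥0, ∀ u : E → ℝ, ContDiff ℝ 1 u → HasCompactSupport u → F u ≤ C * dirichletEnergy Ω u

namespace EnergyDominated

variable {Ω : Set E} {F F' : (E → ℝ) → ℝ≥0∞}

lemma mono (h : EnergyDominated Ω F')
    (hF : ∀ u : E → ℝ, ContDiff ℝ 1 u → HasCompactSupport u → F u ≤ F' u) :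
    EnergyDominated Ω F := by
  obtain ⟨C, hC⟩ := h
  exact ⟨C, fun u h1 h2 => (hF u h1 h2).trans (hC u h1 h2)⟩

lemma add (h : EnergyDominated Ω F) (h' : EnergyDominated Ω F') :
    EnergyDominated Ω (fun u => F u + F' u) := by
  obtain ⟨C, hC⟩ := h
  obtain ⟨C', hC'⟩ := h'
  refine ⟨C + C', fun u h1 h2 => ?_⟩
  rw [ENNReal.coe_add, add_mul]
  exact add_le_add (hC u h1 h2) (hC' u h1 h2)

lemma const_mul (h : EnergyDominated Ω F) {c : ℝ≥0∞} (hc : c ≠ ⊤) :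
    EnergyDominated Ω (fun u => c * F u) := by
  obtain ⟨C, hC⟩ := h
  lift c to ℝ≥0 using hc
  refine ⟨c * C, fun u h1 h2 => ?_⟩
  rw [ENNReal.coe_mul, mul_assoc]
  exact mul_le_mul_right (hC u h1 h2) _

lemma energy : EnergyDominated Ω (dirichletEnergy Ω) := ⟨1, fun u _ _ => by simp⟩

lemma zero : EnergyDominated Ω (fun _ => 0) := ⟨0, fun u _ _ => by simp⟩

end EnergyDominated

/-- Translating a set along a segment that stays in `Ω` changes the square integral of `u` by no more
than the energy. -/
lemma lintegral_comp_add_le_energy {Ω S : Set E} (hΩ : MeasurableSet Ω)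
    {v : E} (hS : ∀ x ∈ S, ∀ t ∈ Ioc (0 : ℝ) 1, x + t • v ∈ Ω) {u : E → ℝ} (hu : ContDiff ℝ 1 u) :
    ∫⁻ x in S, ‖u (x + v)‖ₑ ^ 2 ≤
      2 * ((∫⁻ x in S, ‖u x‖ₑ ^ 2) + ‖v‖ₑ ^ 2 * dirichletEnergy Ω u) := by
  have hcd : Continuous (fderiv ℝ u) := hu.continuous_fderiv one_ne_zero
  have hcu := hu.continuous
  have hpt : ∀ x, ‖u (x + v)‖ₑ ^ 2 ≤
      2 * (‖u x‖ₑ ^ 2 + ‖v‖ₑ ^ 2 * ∫⁻ t in Ioc (0 : ℝ) 1, ‖fderiv ℝ u (x + t • v)‖ₑ ^ 2) := by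
    intro x
    have h1 := enorm_sub_le_lintegral_fderiv hu x v zero_le_one
    simp only [one_smul, zero_smul, add_zero] at h1
    have h2 : ‖u (x + v)‖ₑ ≤ ‖u x‖ₑ + ‖v‖ₑ * ∫⁻ t in Ioc (0 : ℝ) 1, ‖fderiv ℝ u (x + t • v)‖ₑ := by
      calc ‖u (x + v)‖ₑ = ‖u x + (u (x + v) - u x)‖ₑ := by congr 1; ring
        _ ≤ _ := (enorm_add_le _ _).trans (by gcongr)
    refine (pow_le_pow_left' h2 2).trans ((ENNReal.add_sq_le_two_mul _ _).trans ?_)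
    gcongr
    rw [mul_pow]
    gcongr
    refine (lintegral_sq_le_measure_mul _ ?_).trans ?_
    · exact (by fun_prop : Continuous fun t : ℝ => ‖fderiv ℝ u (x + t • v)‖ₑ).aemeasurable
    · simp
  refine (lintegral_mono hpt).trans ?_
  rw [lintegral_const_mul' _ _ (by simp), lintegral_add_left (by fun_prop),
    lintegral_const_mul' _ _ (by simp)]
  gcongr
  rw [lintegral_lintegral_swap]
  · calc ∫⁻ t in Ioc (0 : ℝ) 1, ∫⁻ x in S, ‖fderiv ℝ u (x + t • v)‖ₑ ^ 2
        ≤ ∫⁻ t in Ioc (0 : ℝ) 1, dirichletEnergy Ω u := by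
          refine setLIntegral_mono' measurableSet_Ioc fun t ht => ?_
          have hm : MeasurableSet {x : E | x + t • v ∈ Ω} :=
            hΩ.preimage (measurable_id.add_const _)
          have hsub : S ⊆ {x : E | x + t • v ∈ Ω} := fun x hx => hS x hx t ht
          refine (lintegral_mono_set hsub).trans (le_of_eq ?_)
          rw [dirichletEnergy, ← lintegral_indicator hΩ, ← lintegral_indicator hm,
            ← lintegral_add_right_eq_self (Ω.indicator fun x => ‖fderiv ℝ u x‖ₑ ^ 2) (t • v)]
          rfl
      _ = _ := by simp
  · exact (by fun_prop : Continuous fun z : E × ℝ =>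
      ‖fderiv ℝ u (z.1 + z.2 • v)‖ₑ ^ 2).aemeasurable

/-- Outside a ball containing the complement of `Ω`, integrate along the rays from the origin. Since
`n ≥ 3`, the weight `t^{3/2}` can be distributed so that both factors of the Cauchy–Schwarz
inequality are integrable. -/
lemma energyDominated_annulus {Ω : Set E} (hΩ : MeasurableSet Ω) {r R : ℝ} (hr : 0 < r)
    (hn : 3 ≤ Module.finrank ℝ E) (hΩr : ∀ x : E, r ≤ ‖x‖ → x ∈ Ω) :
    EnergyDominated Ω (fun u => ∫⁻ x in {x | r ≤ ‖x‖ ∧ ‖x‖ ≤ R}, ‖u x‖ₑ ^ 2) := by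
  set A : Set E := {x | r ≤ ‖x‖ ∧ ‖x‖ ≤ R} with hA
  have hAm : MeasurableSet A :=
    (measurableSet_le measurable_const measurable_norm).inter
      (measurableSet_le measurable_norm measurable_const)
  set K : ℝ≥0∞ := ∫⁻ t in Ioi (1 : ℝ), ENNReal.ofReal (t ^ (-(3 / 2) : ℝ)) with hK
  have hKtop : K ≠ ⊤ := by
    have := integrableOn_Ioi_rpow_of_lt (a := (-(3 / 2) : ℝ)) (by norm_num) zero_lt_one
    exact this.lintegral_lt_top.ne
  set f : ℝ → ℝ≥0∞ := fun t => ENNReal.ofReal (t ^ (-(3 / 4) : ℝ)) with hf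
  set f' : ℝ → ℝ≥0∞ := fun t => ENNReal.ofReal (t ^ (3 / 4 : ℝ)) with hf'
  have hfm : Measurable f := by fun_prop
  have hfm' : Measurable f' := by fun_prop
  have hff : ∀ t ∈ Ioi (1 : ℝ), f t * f' t = 1 := by
    intro t ht
    have ht0 : (0 : ℝ) < t := zero_lt_one.trans ht
    rw [hf, hf', ← ENNReal.ofReal_mul (by positivity), ← Real.rpow_add ht0]
    norm_num
  have hf2 : ∫⁻ t in Ioi (1 : ℝ), f t ^ 2 = K := by
    refine setLIntegral_congr_fun measurableSet_Ioi fun t ht => ?_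
    have ht0 : (0 : ℝ) < t := zero_lt_one.trans ht
    simp only [hf]
    rw [← ENNReal.ofReal_pow (by positivity), ← Real.rpow_natCast, ← Real.rpow_mul ht0.le]
    norm_num
  have hmain : ∀ u : E → ℝ, ContDiff ℝ 1 u → HasCompactSupport u → ∫⁻ x in A, ‖u x‖ₑ ^ 2 ≤
      (ENNReal.ofReal R ^ 2 * (K * K)) * dirichletEnergy Ω u := by
    intro u hu hsu
    have hcd : Continuous (fderiv ℝ u) := hu.continuous_fderiv one_ne_zero
    -- the rays leave the support of `u`
    obtain ⟨M, hM⟩ : ∃ M, ∀ x : E, M ≤ ‖x‖ → u x = 0 := by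
      obtain ⟨M, hM⟩ := hsu.isCompact.isBounded.subset_ball 0
      refine ⟨M, fun x hx => image_eq_zero_of_notMem_tsupport fun h => ?_⟩
      have := hM h
      rw [mem_ball_zero_iff] at this
      linarith
    have hray : ∀ x ∈ A, ‖u x‖ₑ ^ 2 ≤ ENNReal.ofReal R ^ 2 *
        (K * ∫⁻ t in Ioi (1 : ℝ), f' t ^ 2 * ‖fderiv ℝ u (t • x)‖ₑ ^ 2) := by
      intro x hx
      have hx0 : 0 < ‖x‖ := hr.trans_le hx.1
      set T : ℝ := max 1 (M / ‖x‖) with hT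
      have hTx : u (T • x) = 0 := by
        apply hM
        rw [norm_smul, Real.norm_of_nonneg (by positivity)]
        calc M = M / ‖x‖ * ‖x‖ := by field_simp
          _ ≤ T * ‖x‖ := by gcongr; exact le_max_right _ _
      have h1 := enorm_sub_le_lintegral_fderiv hu 0 x (le_max_left 1 (M / ‖x‖))
      simp only [zero_add, one_smul, ← hT, hTx, zero_sub, enorm_neg] at h1
      have h2 : ∫⁻ t in Ioc 1 T, ‖fderiv ℝ u (t • x)‖ₑ ≤
          ∫⁻ t in Ioi (1 : ℝ), f t * (f' t * ‖fderiv ℝ u (t • x)‖ₑ) := by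
        refine (lintegral_mono_set Ioc_subset_Ioi_self).trans (le_of_eq ?_)
        refine setLIntegral_congr_fun measurableSet_Ioi fun t ht => ?_
        simp only [← mul_assoc, hff t ht, one_mul]
      have hxR : ‖x‖ₑ ≤ ENNReal.ofReal R := by
        rw [← ofReal_norm]
        exact ENNReal.ofReal_le_ofReal hx.2
      refine (pow_le_pow_left' (h1.trans (mul_le_mul' hxR h2)) 2).trans ?_
      rw [mul_pow]
      gcongr
      refine (lintegral_mul_sq_le _ hfm.aemeasurable ?_).trans ?_
      · have : Continuous fun t : ℝ => ‖fderiv ℝ u (t • x)‖ₑ := by fun_prop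
        exact (hfm'.mul this.measurable).aemeasurable
      · rw [hf2]
        simp only [mul_pow, le_refl]
    calc ∫⁻ x in A, ‖u x‖ₑ ^ 2
        ≤ ∫⁻ x in A, ENNReal.ofReal R ^ 2 *
          (K * ∫⁻ t in Ioi (1 : ℝ), f' t ^ 2 * ‖fderiv ℝ u (t • x)‖ₑ ^ 2) :=
          setLIntegral_mono' hAm hray
      _ = ENNReal.ofReal R ^ 2 * (K *
          ∫⁻ x in A, ∫⁻ t in Ioi (1 : ℝ), f' t ^ 2 * ‖fderiv ℝ u (t • x)‖ₑ ^ 2) := by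
          rw [lintegral_const_mul' _ _ (by finiteness), lintegral_const_mul' _ _ hKtop]
      _ = ENNReal.ofReal R ^ 2 * (K *
          ∫⁻ t in Ioi (1 : ℝ), f' t ^ 2 * ∫⁻ x in A, ‖fderiv ℝ u (t • x)‖ₑ ^ 2) := by
          rw [lintegral_lintegral_swap]
          · congr 2
            refine lintegral_congr fun t => ?_
            rw [lintegral_const_mul' _ _ (by simp [hf'])]
          · have h1 : Continuous fun z : E × ℝ => ‖fderiv ℝ u (z.2 • z.1)‖ₑ ^ 2 := by fun_prop
            exact (((hfm'.comp measurable_snd).pow_const 2).mul h1.measurable).aemeasurable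
      _ ≤ ENNReal.ofReal R ^ 2 * (K *
          ∫⁻ t in Ioi (1 : ℝ), ENNReal.ofReal (t ^ (-(3 / 2) : ℝ)) * dirichletEnergy Ω u) := by
          refine mul_le_mul_right (mul_le_mul_right ?_ _) _
          refine setLIntegral_mono' measurableSet_Ioi fun t ht => ?_
          have ht1 : (1 : ℝ) < t := ht
          have ht0 : (0 : ℝ) < t := zero_lt_one.trans ht
          have hsc : ∫⁻ x in A, ‖fderiv ℝ u (t • x)‖ₑ ^ 2 ≤
              ENNReal.ofReal (t ^ (-3 : ℝ)) * dirichletEnergy Ω u := by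
            calc ∫⁻ x in A, ‖fderiv ℝ u (t • x)‖ₑ ^ 2
                ≤ ∫⁻ x, Ω.indicator (fun y => ‖fderiv ℝ u y‖ₑ ^ 2) (t • x) := by
                  rw [← lintegral_indicator hAm]
                  refine lintegral_mono fun x => ?_
                  by_cases hx : x ∈ A
                  · have : t • x ∈ Ω := by
                      apply hΩr
                      rw [norm_smul, Real.norm_of_nonneg ht0.le]
                      nlinarith [hx.1]
                    simp [hx, this]
                  · simp [hx]
              _ = ∫⁻ y, Ω.indicator (fun y => ‖fderiv ℝ u y‖ₑ ^ 2) y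
                    ∂(Measure.map (t • ·) volume) := by
                  rw [lintegral_map]
                  · exact (by fun_prop : Continuous fun y =>
                      ‖fderiv ℝ u y‖ₑ ^ 2).measurable.indicator hΩ
                  · exact measurable_const_smul t
              _ ≤ _ := by
                  rw [Measure.map_addHaar_smul _ ht0.ne', lintegral_smul_measure,
                    lintegral_indicator hΩ, smul_eq_mul, dirichletEnergy]
                  gcongr
                  rw [abs_of_pos (by positivity), Real.rpow_neg ht0.le]
                  gcongr
                  rw [show (3 : ℝ) = ((3 : ℕ) : ℝ) by norm_num, Real.rpow_natCast]
                  exact pow_le_pow_right₀ ht1.le hn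
          refine (mul_le_mul_right hsc _).trans (le_of_eq ?_)
          rw [← mul_assoc, hf', ← ENNReal.ofReal_pow (by positivity),
            ← ENNReal.ofReal_mul (by positivity), ← Real.rpow_natCast, ← Real.rpow_mul ht0.le,
            ← Real.rpow_add ht0]
          norm_num
      _ = _ := by
          rw [lintegral_mul_const _ (by fun_prop), ← hK]
          ring
  refine ⟨(ENNReal.ofReal R ^ 2 * (K * K)).toNNReal, fun u hu hsu => ?_⟩
  rw [ENNReal.coe_toNNReal (by finiteness)]
  exact hmain u hu hsu

/-- Every point of a connected open exterior domain has a neighbourhood on which the square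
integral is controlled by the energy: this property is open, holds far away, and propagates by
translation along segments. -/
lemma energyDominated_ball_of_mem {Ω : Set E} (hΩ : IsOpen Ω) (hc : IsPreconnected Ω)
    (hb : Bornology.IsBounded Ωᶜ) (hn : 3 ≤ Module.finrank ℝ E) {x : E} (hx : x ∈ Ω) :
    ∃ r > 0, EnergyDominated Ω (fun u => ∫⁻ y in Metric.ball x r, ‖u y‖ₑ ^ 2) := by
  set S : Set E :=
    {x | ∃ r > 0, EnergyDominated Ω (fun u => ∫⁻ y in Metric.ball x r, ‖u y‖ₑ ^ 2)} with hS
  suffices h : Ω ⊆ S from h hx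
  refine hc.subset_of_closure_inter_subset ?_ ?_ ?_
  · rw [Metric.isOpen_iff]
    rintro y ⟨r, hr, h⟩
    refine ⟨r / 2, by positivity, fun z hz => ⟨r / 2, by positivity, h.mono fun u _ _ => ?_⟩⟩
    refine lintegral_mono_set (Metric.ball_subset_ball' ?_)
    rw [Metric.mem_ball] at hz
    linarith
  · obtain ⟨r₀, hr₀⟩ := hb.subset_ball 0
    set r : ℝ := max r₀ 1
    have hr : 0 < r := by positivity
    have hΩr : ∀ x : E, r ≤ ‖x‖ → x ∈ Ω := by
      intro x hx
      by_contra h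
      have := hr₀ h
      rw [mem_ball_zero_iff] at this
      linarith [le_max_left r₀ 1]
    have : Nontrivial E := Module.nontrivial_of_finrank_pos (R := ℝ) (by omega)
    obtain ⟨y, hy⟩ := exists_norm_eq E (c := r + 1) (by positivity)
    refine ⟨y, hΩr y (by linarith), 1, one_pos,
      (energyDominated_annulus (R := r + 2) hΩ.measurableSet hr hn hΩr).mono fun u _ _ => ?_⟩
    refine lintegral_mono_set fun z hz => ?_
    rw [mem_ball_iff_norm] at hz
    have h1 := norm_sub_norm_le y z
    have h2 := norm_sub_norm_le z y
    rw [norm_sub_rev] at h1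
    constructor <;> linarith
  · rintro x ⟨hxS, hxΩ⟩
    obtain ⟨r, hr, hball⟩ := Metric.isOpen_iff.1 hΩ x hxΩ
    obtain ⟨y, ⟨r', hr', hy⟩, hxy⟩ := Metric.mem_closure_iff.1 hxS (r / 2) (by positivity)
    refine ⟨min r' (r / 2), by positivity, ?_⟩
    set ρ := min r' (r / 2)
    have hdom := ((hy.mono (F := fun u => ∫⁻ z in Metric.ball y ρ, ‖u z‖ₑ ^ 2) fun u _ _ =>
      lintegral_mono_set (Metric.ball_subset_ball (min_le_left _ _))).add
      (EnergyDominated.energy.const_mul (c := ‖x - y‖ₑ ^ 2) (by finiteness))).const_mul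
        (c := 2) (by finiteness)
    refine hdom.mono fun u hu _ => ?_
    refine le_trans (le_of_eq ?_) (lintegral_comp_add_le_energy (S := Metric.ball y ρ)
      (v := x - y) hΩ.measurableSet ?_ hu)
    · rw [← lintegral_indicator measurableSet_ball, ← lintegral_indicator measurableSet_ball,
        ← lintegral_add_right_eq_self _ (x - y)]
      refine lintegral_congr fun z => ?_
      have : z + (x - y) ∈ Metric.ball x ρ ↔ z ∈ Metric.ball y ρ := by
        simp only [mem_ball_iff_norm]
        rw [show z + (x - y) - x = z - y by abel]
      by_cases hz : z ∈ Metric.ball y ρ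
      · rw [indicator_of_mem hz, indicator_of_mem (this.2 hz)]
      · rw [indicator_of_notMem hz, indicator_of_notMem (fun h => hz (this.1 h))]
    · intro z hz t ht
      apply hball
      rw [mem_ball_iff_norm] at hz ⊢
      have : z + t • (x - y) - x = (z - y) - (1 - t) • (x - y) := by
        module
      rw [this]
      have h1 : ‖(1 - t) • (x - y)‖ ≤ ‖x - y‖ := by
        rw [norm_smul, Real.norm_of_nonneg (by linarith [ht.2])]
        nlinarith [norm_nonneg (x - y), ht.1]
      have h2 := norm_sub_le (z - y) ((1 - t) • (x - y))
      have h3 : ρ ≤ r / 2 := min_le_right _ _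
      rw [dist_eq_norm] at hxy
      linarith

end EnergyControl

section Graph

variable {E : Type*} [NormedAddCommGroup E] [InnerProductSpace ℝ E]

/-! ### Graph coordinates at the boundary -/

/-- The signed height, in the direction `N`, of a point above the graph of `γ` over `N^⊥`. -/
def graphHeight (N : E) (γ : E → ℝ) (x : E) : ℝ := inner ℝ N x - γ (x - inner ℝ N x • N)

lemma graphHeight_add_smul {N : E} (hN : ‖N‖ = 1) (γ : E → ℝ) (x : E) (s : ℝ) :
    graphHeight N γ (x + s • N) = graphHeight N γ x + s := by
  have h1 : inner ℝ N (x + s • N) = inner ℝ N x + s := by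
    rw [inner_add_right, inner_smul_right, real_inner_self_eq_norm_sq, hN]
    ring
  have h2 : x + s • N - (inner ℝ N x + s) • N = x - inner ℝ N x • N := by module
  rw [graphHeight, graphHeight, h1, h2]
  ring

lemma contDiff_graphHeight {N : E} {γ : E → ℝ} {k : ℕ∞ω} (hγ : ContDiff ℝ k γ) :
    ContDiff ℝ k (graphHeight N γ) := by
  unfold graphHeight
  have h : ContDiff ℝ k fun x : E => inner ℝ N x := contDiff_const.inner ℝ contDiff_id
  exact h.sub (hγ.comp (contDiff_id.sub (h.smul contDiff_const)))

lemma fderiv_graphHeight_apply_normal {N : E} (hN : ‖N‖ = 1) {γ : E → ℝ} (hγ : ContDiff ℝ 1 γ)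
    (x : E) : fderiv ℝ (graphHeight N γ) x N = 1 := by
  have h1 : HasDerivAt (fun s : ℝ => x + s • N) N 0 := by
    simpa using ((hasDerivAt_id (0 : ℝ)).smul_const N).const_add x
  have hd : DifferentiableAt ℝ (graphHeight N γ) (x + (0 : ℝ) • N) :=
    (contDiff_graphHeight hγ).differentiable one_ne_zero _
  have h2 := hd.hasFDerivAt.comp_hasDerivAt (0 : ℝ) h1
  have h3 : HasDerivAt (fun s : ℝ => graphHeight N γ (x + s • N)) 1 0 := by
    simp only [graphHeight_add_smul hN]
    simpa using (hasDerivAt_id (0 : ℝ)).const_add (graphHeight N γ x)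
  have h4 := h2.unique h3
  simpa using h4

lemma graphHeight_eq_zero_of_mem_frontier {Ω : Set E} {N : E} {γ : E → ℝ}
    (hγ : Continuous (graphHeight N γ)) {x₀ : E} {r : ℝ}
    (hΩ : ∀ x ∈ Metric.ball x₀ r, x ∈ Ω ↔ graphHeight N γ x < 0) {x : E}
    (hx : x ∈ Metric.ball x₀ r) (hxf : x ∈ frontier Ω) : graphHeight N γ x = 0 := by
  rcases lt_trichotomy (graphHeight N γ x) 0 with h | h | h
  · refine absurd ?_ hxf.2
    rw [mem_interior_iff_mem_nhds]
    filter_upwards [Metric.isOpen_ball.mem_nhds hx, hγ.continuousAt.eventually_lt_const h] with y hy hy'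
    exact (hΩ y hy).2 hy'
  · exact h
  · refine absurd hxf.1 ?_
    rw [← mem_compl_iff, ← interior_compl, mem_interior_iff_mem_nhds]
    filter_upwards [Metric.isOpen_ball.mem_nhds hx, hγ.continuousAt.eventually_const_lt h] with y hy hy'
    exact fun hyΩ => absurd ((hΩ y hy).1 hyΩ) (not_lt.2 hy'.le)

variable [FiniteDimensional ℝ E] [MeasurableSpace E] [BorelSpace E]

/-- Quantities that are monotone and quasi-subadditive in a set are controlled by the energy on a
compact set as soon as they are controlled near each of its points. -/
lemma EnergyDominated.of_isCompact {Ω K : Set E} (hK : IsCompact K)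
    {F : Set E → (E → ℝ) → ℝ≥0∞} {c : ℝ≥0∞} (hc : c ≠ ⊤) (h0 : ∀ u, F ∅ u = 0)
    (hmono : ∀ u s t, s ⊆ t → F s u ≤ F t u)
    (hunion : ∀ u s t, F (s ∪ t) u ≤ c * (F s u + F t u))
    (hloc : ∀ x ∈ K, ∃ r > 0, EnergyDominated Ω (F (Metric.ball x r))) :
    EnergyDominated Ω (F K) := by
  refine hK.induction_on (p := fun s => EnergyDominated Ω (F s)) ?_ ?_ ?_ ?_
  · exact EnergyDominated.zero.mono fun u _ _ => (h0 u).le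
  · exact fun s t hst ht => ht.mono fun u _ _ => hmono u s t hst
  · exact fun s t hs ht => ((hs.add ht).const_mul hc).mono fun u _ _ => hunion u s t
  · intro x hx
    obtain ⟨r, hr, h⟩ := hloc x hx
    exact ⟨_, mem_nhdsWithin_of_mem_nhds (Metric.ball_mem_nhds x hr), h⟩

/-- Near a boundary point, translate along the graph direction into the interior. -/
lemma energyDominated_ball_of_mem_frontier {Ω : Set E} (hΩ : IsOpen Ω) (hc : IsPreconnected Ω)
    (hb : Bornology.IsBounded Ωᶜ) (hn : 3 ≤ Module.finrank ℝ E) {N : E} (hN : ‖N‖ = 1) {γ : E → ℝ}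
    (hγ : Continuous (graphHeight N γ)) {x₀ : E} {r : ℝ} (hr : 0 < r)
    (hΩg : ∀ x ∈ Metric.ball x₀ r, x ∈ Ω ↔ graphHeight N γ x < 0) (hx₀ : x₀ ∈ frontier Ω) :
    ∃ ρ > 0, EnergyDominated Ω (fun u => ∫⁻ y in Metric.ball x₀ ρ ∩ Ω, ‖u y‖ₑ ^ 2) := by
  have hzero := graphHeight_eq_zero_of_mem_frontier hγ hΩg (Metric.mem_ball_self hr) hx₀
  have hshift : ∀ x ∈ Metric.ball x₀ (r / 2), ∀ s : ℝ, 0 ≤ s → s ≤ r / 2 →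
      graphHeight N γ x < s → x - s • N ∈ Ω := by
    intro x hx s hs hs' hxs
    have heq : x - s • N = x + (-s) • N := by module
    rw [heq, hΩg]
    · rw [graphHeight_add_smul hN]
      linarith
    · rw [mem_ball_iff_norm] at hx ⊢
      rw [show x + -s • N - x₀ = (x - x₀) + -s • N by abel]
      refine (norm_add_le _ _).trans_lt ?_
      rw [norm_smul, hN, norm_neg, Real.norm_of_nonneg hs]
      linarith
  set z : E := x₀ - (r / 2) • N with hz
  have hzΩ : z ∈ Ω := hshift x₀ (Metric.mem_ball_self (by positivity)) (r / 2) (by positivity) le_rfl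
    (by rw [hzero]; positivity)
  obtain ⟨r', hr', hdom⟩ := energyDominated_ball_of_mem hΩ hc hb hn hzΩ
  refine ⟨min r' (r / 2), by positivity, ?_⟩
  set ρ := min r' (r / 2)
  set v : E := (r / 2) • N with hv
  refine ((hdom.add (EnergyDominated.energy.const_mul (c := ‖v‖ₑ ^ 2) (by finiteness))).const_mul
    (c := 2) (by finiteness)).mono fun u hu _ => ?_
  set S : Set E := {x | x + v ∈ Metric.ball x₀ ρ ∩ Ω} with hS
  have hm : MeasurableSet (Metric.ball x₀ ρ ∩ Ω) := measurableSet_ball.inter hΩ.measurableSet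
  have hSm : MeasurableSet S := hm.preimage (measurable_id.add_const v)
  have hkey := lintegral_comp_add_le_energy (S := S) (v := v) hΩ.measurableSet ?_ hu
  · refine le_trans (le_of_eq ?_) (hkey.trans ?_)
    · rw [← lintegral_indicator hm, ← lintegral_indicator hSm,
        ← lintegral_add_right_eq_self _ v]
      rfl
    · gcongr
      intro x hx
      have h1 := hx.1
      rw [mem_ball_iff_norm] at h1 ⊢
      rw [show x - z = x + v - x₀ by rw [hz]; abel]
      exact h1.trans_le (min_le_left _ _)
  · intro x hx t ht
    have h1 : x + v ∈ Metric.ball x₀ (r / 2) := Metric.ball_subset_ball (min_le_right _ _) hx.1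
    have h2 : graphHeight N γ (x + v) < 0 :=
      (hΩg _ (Metric.ball_subset_ball (by linarith) h1)).1 hx.2
    have h3 := hshift (x + v) h1 ((1 - t) * (r / 2))
      (by have := ht.2; nlinarith) (by have := ht.1; nlinarith)
      (h2.trans_le (by have := ht.2; nlinarith))
    rwa [show x + v - ((1 - t) * (r / 2)) • N = x + t • v by rw [hv]; module] at h3

end Graph

section Reflection

variable {E : Type*} [NormedAddCommGroup E] [InnerProductSpace ℝ E]

/-! ### Extension across a graph by reflection -/

/-- A `C¹` function that vanishes to first order on `{g = 0}` stays `C¹` when it is replaced by zero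
in `{g ≤ 0}`. -/
lemma contDiff_one_ite_pos {g W : E → ℝ} (hg : Continuous g) (hW : ContDiff ℝ 1 W)
    (h0 : ∀ x, g x = 0 → W x = 0) (h1 : ∀ x, g x = 0 → fderiv ℝ W x = 0) :
    ContDiff ℝ 1 (fun x => if 0 < g x then W x else 0) ∧
      ∀ x, HasFDerivAt (fun x => if 0 < g x then W x else 0)
        (if 0 < g x then fderiv ℝ W x else 0) x := by
  have hder : ∀ x, HasFDerivAt (fun x => if 0 < g x then W x else 0)
        (if 0 < g x then fderiv ℝ W x else 0) x := by
    intro x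
    have hWx := (hW.differentiable one_ne_zero x).hasFDerivAt
    rcases lt_trichotomy (g x) 0 with h | h | h
    · rw [if_neg h.not_gt]
      refine (hasFDerivAt_const (0 : ℝ) x).congr_of_eventuallyEq ?_
      filter_upwards [hg.continuousAt.eventually_lt_const h] with y hy
      rw [if_neg hy.not_gt]
    · rw [h1 x h] at hWx
      rw [if_neg (by rw [h]; exact lt_irrefl _)]
      rw [hasFDerivAt_iff_isLittleO] at hWx ⊢
      refine (Asymptotics.IsBigO.of_bound 1 ?_).trans_isLittleO hWx
      filter_upwards with y
      have hx : ¬ 0 < g x := by rw [h]; exact lt_irrefl _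
      by_cases hy : 0 < g y
      · simp [hx, hy, h0 x h]
      · simp [hx, hy]
    · rw [if_pos h]
      refine hWx.congr_of_eventuallyEq ?_
      filter_upwards [hg.continuousAt.eventually_const_lt h] with y hy
      rw [if_pos hy]
  refine ⟨contDiff_one_iff_hasFDerivAt.2 ⟨_, ?_, hder⟩, hder⟩
  refine Continuous.if ?_ (hW.continuous_fderiv one_ne_zero) continuous_const
  intro x hx
  exact h1 x (frontier_lt_subset_eq continuous_const hg hx).symm

/-- The map that fixes the graph of `γ` and multiplies the height above it by `1 - κ`. For `κ = 2`
it is the reflection in the graph along `N`. -/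
def graphReflection (N : E) (γ : E → ℝ) (κ : ℝ) (x : E) : E := x - (κ * graphHeight N γ x) • N

lemma graphHeight_graphReflection {N : E} (hN : ‖N‖ = 1) (γ : E → ℝ) (κ : ℝ) (x : E) :
    graphHeight N γ (graphReflection N γ κ x) = (1 - κ) * graphHeight N γ x := by
  rw [graphReflection, sub_eq_add_neg, ← neg_smul, graphHeight_add_smul hN]
  ring

lemma graphReflection_graphReflection {N : E} (hN : ‖N‖ = 1) (γ : E → ℝ) {κ κ' : ℝ}
    (h : κ + κ' * (1 - κ) = 0) (x : E) :
    graphReflection N γ κ' (graphReflection N γ κ x) = x := by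
  rw [graphReflection, graphHeight_graphReflection hN, graphReflection, sub_sub, ← add_smul,
    show κ * graphHeight N γ x + κ' * ((1 - κ) * graphHeight N γ x)
      = (κ + κ' * (1 - κ)) * graphHeight N γ x by ring, h]
  simp

lemma contDiff_graphReflection {N : E} {γ : E → ℝ} {k : ℕ∞ω} (hγ : ContDiff ℝ k γ) (κ : ℝ) :
    ContDiff ℝ k (graphReflection N γ κ) :=
  contDiff_id.sub ((contDiff_const.mul (contDiff_graphHeight hγ)).smul contDiff_const)

lemma hasFDerivAt_graphReflection {N : E} {γ : E → ℝ} (hγ : ContDiff ℝ 1 γ) (κ : ℝ) (x : E) :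
    HasFDerivAt (graphReflection N γ κ)
      (ContinuousLinearMap.id ℝ E - (κ • fderiv ℝ (graphHeight N γ) x).smulRight N) x := by
  have h := ((contDiff_graphHeight (N := N) hγ).differentiable one_ne_zero x).hasFDerivAt
  exact (hasFDerivAt_id x).sub ((h.const_mul κ).smul_const N)

lemma det_fderiv_graphReflection [FiniteDimensional ℝ E] {N : E} (hN : ‖N‖ = 1) {γ : E → ℝ}
    (hγ : ContDiff ℝ 1 γ) (κ : ℝ) (x : E) :
    (ContinuousLinearMap.id ℝ E - (κ • fderiv ℝ (graphHeight N γ) x).smulRight N).det = 1 - κ := by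
  have h : ((ContinuousLinearMap.id ℝ E -
      (κ • fderiv ℝ (graphHeight N γ) x).smulRight N : E →L[ℝ] E) : E →ₗ[ℝ] E) =
      LinearMap.transvection (-(κ • (fderiv ℝ (graphHeight N γ) x : E →ₗ[ℝ] ℝ))) N := by
    ext y
    simp [LinearMap.transvection.apply, sub_eq_add_neg]
  rw [ContinuousLinearMap.det, h, LinearMap.transvection.det]
  simp [fderiv_graphHeight_apply_normal hN hγ x, sub_eq_add_neg]

/-- The graph reflection with `κ ≠ 1` as a homeomorphism. -/
def graphReflectionHomeomorph {N : E} (hN : ‖N‖ = 1) {γ : E → ℝ}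
    (hγ : ContDiff ℝ 1 γ) {κ κ' : ℝ} (h : κ + κ' * (1 - κ) = 0) (h' : κ' + κ * (1 - κ') = 0) :
    E ≃ₜ E where
  toFun := graphReflection N γ κ
  invFun := graphReflection N γ κ'
  left_inv := graphReflection_graphReflection hN γ h
  right_inv := graphReflection_graphReflection hN γ h'
  continuous_toFun := (contDiff_graphReflection hγ κ).continuous
  continuous_invFun := (contDiff_graphReflection hγ κ').continuous

variable [FiniteDimensional ℝ E] [MeasurableSpace E] [BorelSpace E]

lemma setLIntegral_comp_graphReflection_le {N : E} (hN : ‖N‖ = 1) {γ : E → ℝ}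
    (hγ : ContDiff ℝ 1 γ) {κ κ' : ℝ} (h : κ + κ' * (1 - κ) = 0) (hκ : 1 < κ) (F : E → ℝ≥0∞) :
    ∫⁻ x in {x | 0 < graphHeight N γ x}, F (graphReflection N γ κ x) ≤
      (ENNReal.ofReal (κ - 1))⁻¹ * ∫⁻ x in {x | graphHeight N γ x < 0}, F x := by
  have hg : Continuous (graphHeight N γ) := (contDiff_graphHeight hγ).continuous
  have hinj : Function.Injective (graphReflection N γ κ) :=
    Function.LeftInverse.injective (graphReflection_graphReflection hN γ h)
  have hm : MeasurableSet {x | 0 < graphHeight N γ x} :=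
    (isOpen_lt continuous_const hg).measurableSet
  have key := lintegral_image_eq_lintegral_abs_det_fderiv_mul (volume : Measure E) hm
    (fun x _ => (hasFDerivAt_graphReflection (N := N) hγ κ x).hasFDerivWithinAt) hinj.injOn F
  simp only [det_fderiv_graphReflection hN hγ] at key
  rw [abs_of_neg (by linarith), neg_sub, lintegral_const_mul' _ _ ENNReal.ofReal_ne_top] at key
  have h0 : ENNReal.ofReal (κ - 1) ≠ 0 := by
    rw [Ne, ENNReal.ofReal_eq_zero, not_le]
    linarith
  have himg : graphReflection N γ κ '' {x | 0 < graphHeight N γ x} ⊆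
      {x | graphHeight N γ x < 0} := by
    rintro _ ⟨x, hx, rfl⟩
    simp only [mem_ofPred_eq] at hx ⊢
    rw [graphHeight_graphReflection hN]
    nlinarith
  calc ∫⁻ x in {x | 0 < graphHeight N γ x}, F (graphReflection N γ κ x)
      = (ENNReal.ofReal (κ - 1))⁻¹ * (ENNReal.ofReal (κ - 1) *
          ∫⁻ x in {x | 0 < graphHeight N γ x}, F (graphReflection N γ κ x)) := by
        rw [← mul_assoc, ENNReal.inv_mul_cancel h0 ENNReal.ofReal_ne_top, one_mul]
    _ ≤ _ := by
        rw [← key]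
        exact mul_le_mul_right (lintegral_mono_set himg) _

/-- A graph is a null set: it has uncountably many disjoint translates. -/
lemma volume_graphHeight_eq_zero {N : E} (hN : ‖N‖ = 1) {γ : E → ℝ}
    (hγ : Continuous (graphHeight N γ)) : volume {x | graphHeight N γ x = 0} = 0 := by
  by_contra hne
  have hcount := Measure.countable_meas_level_set_pos (μ := (volume : Measure E)) hγ.measurable
  have huniv : {s : ℝ | 0 < volume {x | graphHeight N γ x = s}} = univ := by
    refine eq_univ_of_forall fun s => ?_
    have : {x | graphHeight N γ x = 0} = (fun x => x + s • N) ⁻¹' {x | graphHeight N γ x = s} := by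
      ext x
      simp [graphHeight_add_smul hN]
    rw [this, measure_preimage_add_right] at hne
    exact pos_iff_ne_zero.2 hne
  rw [huniv] at hcount
  exact Cardinal.not_countable_real hcount

/-! ### The Sobolev inequality below a graph -/

lemma eLpNorm_two_sq_eq_lintegral {X F : Type*} [MeasurableSpace X] [NormedAddCommGroup F]
    (μ : Measure X) (f : X → F) : eLpNorm f 2 μ ^ 2 = ∫⁻ x, ‖f x‖ₑ ^ 2 ∂μ := by
  have h := eLpNorm_nnreal_pow_eq_lintegral (μ := μ) (f := f) (p := 2) two_ne_zero
  simpa using h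

lemma exists_eLpNorm_sq_le_lintegral_fderiv {p : ℝ≥0} (hE : 0 < Module.finrank ℝ E)
    (hp : (p : ℝ)⁻¹ = 2⁻¹ - (Module.finrank ℝ E : ℝ)⁻¹) :
    ∃ C : ℝ≥0, ∀ u : E → ℝ, ContDiff ℝ 1 u → HasCompactSupport u →
      eLpNorm u p volume ^ 2 ≤ C * ∫⁻ x, ‖fderiv ℝ u x‖ₑ ^ 2 := by
  refine ⟨SNormLESNormFDerivOfEqConst ℝ (volume : Measure E) 2 ^ 2, fun u hu hsu => ?_⟩
  have h := eLpNorm_le_eLpNorm_fderiv_of_eq (volume : Measure E) hu hsu (p := 2) (p' := p)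
    (by norm_num) hE (by simpa using hp)
  refine (pow_le_pow_left' h 2).trans (le_of_eq ?_)
  rw [mul_pow, ← eLpNorm_two_sq_eq_lintegral]
  simp

/-- The Sobolev inequality below a `C¹` graph, for functions supported in a compact set: extend
across the graph by `4 v(σ_{3/2} x) - 3 v(σ_2 x)`, where `σ_κ` is the graph reflection, which
matches `v` and its derivative on the graph, so that the extension is `C¹`. -/
lemma exists_eLpNorm_sq_le_lintegral_fderiv_below_graph {p : ℝ≥0} (hE : 0 < Module.finrank ℝ E)
    (hp : (p : ℝ)⁻¹ = 2⁻¹ - (Module.finrank ℝ E : ℝ)⁻¹) {N : E} (hN : ‖N‖ = 1) {γ : E → ℝ}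
    (hγ : ContDiff ℝ 1 γ) {K : Set E} (hK : IsCompact K) :
    ∃ C : ℝ≥0, ∀ v : E → ℝ, ContDiff ℝ 1 v → tsupport v ⊆ K →
      eLpNorm v p (volume.restrict {x | graphHeight N γ x < 0}) ^ 2 ≤
        C * ∫⁻ x in {x | graphHeight N γ x < 0}, ‖fderiv ℝ v x‖ₑ ^ 2 := by
  obtain ⟨C, hC⟩ := exists_eLpNorm_sq_le_lintegral_fderiv (E := E) hE hp
  set g := graphHeight N γ with hgdef
  have hgc : ContDiff ℝ 1 g := contDiff_graphHeight hγ
  have hg : Continuous g := hgc.continuous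
  set a := graphReflection N γ (3 / 2) with ha
  set b := graphReflection N γ 2 with hb
  let ea := graphReflectionHomeomorph hN hγ (κ := 3 / 2) (κ' := 3) (by norm_num) (by norm_num)
  let eb := graphReflectionHomeomorph hN hγ (κ := 2) (κ' := 2) (by norm_num) (by norm_num)
  have hac : ContDiff ℝ 1 a := contDiff_graphReflection hγ _
  have hbc : ContDiff ℝ 1 b := contDiff_graphReflection hγ _
  have hbound : ∀ σ : E → E, ContDiff ℝ 1 σ → IsCompact (σ ⁻¹' K) →
      ∃ L : ℝ≥0, ∀ x, σ x ∈ K → ‖fderiv ℝ σ x‖₊ ≤ L := by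
    intro σ hσ hσK
    obtain ⟨L, hL⟩ := hσK.exists_bound_of_continuousOn
      (hσ.continuous_fderiv one_ne_zero).continuousOn
    refine ⟨L.toNNReal, fun x hx => ?_⟩
    rw [← NNReal.coe_le_coe, coe_nnnorm]
    exact (hL x hx).trans (Real.le_coe_toNNReal L)
  obtain ⟨La, hLa⟩ := hbound a hac (ea.isCompact_preimage.2 hK)
  obtain ⟨Lb, hLb⟩ := hbound b hbc (eb.isCompact_preimage.2 hK)
  refine ⟨C * (1 + 2 * (16 * La ^ 2 * 2 + 9 * Lb ^ 2)), fun v hv hsv => ?_⟩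
  have hcv : HasCompactSupport v := hK.of_isClosed_subset (isClosed_tsupport v) hsv
  have hvd : ∀ x, HasFDerivAt v (fderiv ℝ v x) x := fun x =>
    (hv.differentiable one_ne_zero x).hasFDerivAt
  -- the correction that is added above the graph
  set W : E → ℝ := fun x => 4 * v (a x) - 3 * v (b x) - v x with hW
  have hWc : ContDiff ℝ 1 W :=
    ((contDiff_const.mul (hv.comp hac)).sub (contDiff_const.mul (hv.comp hbc))).sub hv
  have hWd : ∀ x, HasFDerivAt W ((4 : ℝ) • (fderiv ℝ v (a x)).comp (fderiv ℝ a x) -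
      (3 : ℝ) • (fderiv ℝ v (b x)).comp (fderiv ℝ b x) - fderiv ℝ v x) x := by
    intro x
    have h1 := (hvd (a x)).comp x (hac.differentiable one_ne_zero x).hasFDerivAt
    have h2 := (hvd (b x)).comp x (hbc.differentiable one_ne_zero x).hasFDerivAt
    exact ((h1.const_mul 4).sub (h2.const_mul 3)).sub (hvd x)
  have hfix : ∀ κ x, g x = 0 → graphReflection N γ κ x = x := by
    intro κ x hx
    rw [graphReflection, ← hgdef, hx]
    simp
  obtain ⟨hVc, hVd⟩ := contDiff_one_ite_pos hg hWc
    (by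
      intro x hx
      simp only [hW, ha, hb, hfix _ x hx]
      ring)
    (by
      intro x hx
      rw [(hWd x).fderiv, (hasFDerivAt_graphReflection (N := N) hγ _ x).fderiv,
        (hasFDerivAt_graphReflection (N := N) hγ _ x).fderiv, ha, hb, hfix _ x hx, hfix _ x hx]
      ext y
      simp
      ring)
  set V : E → ℝ := fun x => v x + if 0 < g x then W x else 0 with hV
  have hVC : ContDiff ℝ 1 V := hv.add hVc
  have hVS : HasCompactSupport V := by
    have h1 : HasCompactSupport W :=
      (((hcv.comp_homeomorph ea).mul_left (f := fun _ => 4)).sub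
        ((hcv.comp_homeomorph eb).mul_left (f := fun _ => 3))).sub hcv
    refine hcv.add (h1.mono ?_)
    intro x hx
    rw [Function.mem_support] at hx ⊢
    intro h
    apply hx
    simp [h]
  have hVder : ∀ x, fderiv ℝ V x = if 0 < g x then
      (4 : ℝ) • (fderiv ℝ v (a x)).comp (fderiv ℝ a x) -
      (3 : ℝ) • (fderiv ℝ v (b x)).comp (fderiv ℝ b x) else fderiv ℝ v x := by
    intro x
    have h := (hvd x).add (hVd x)
    rw [show V = v + (fun x => if 0 < g x then W x else 0) from rfl, h.fderiv, (hWd x).fderiv]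
    split_ifs <;> abel
  have hcomp : ∀ (σ : E → E) (L : ℝ≥0), (∀ x, σ x ∈ K → ‖fderiv ℝ σ x‖₊ ≤ L) → ∀ x,
      ‖(fderiv ℝ v (σ x)).comp (fderiv ℝ σ x)‖ₑ ≤ L * ‖fderiv ℝ v (σ x)‖ₑ := by
    intro σ L hL x
    by_cases hx : σ x ∈ K
    · rw [mul_comm]
      refine (ContinuousLinearMap.opENorm_comp_le _ _).trans ?_
      gcongr
      exact ENNReal.coe_le_coe.2 (hL x hx)
    · have : fderiv ℝ v (σ x) = 0 :=
        image_eq_zero_of_notMem_tsupport fun h => hx (hsv (tsupport_fderiv_subset ℝ h))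
      rw [this, ContinuousLinearMap.zero_comp]
      refine le_of_eq_of_le ?_ zero_le
      rw [← ofReal_norm, norm_zero, ENNReal.ofReal_zero]
  have hpos : ∀ x, 0 < g x → ‖fderiv ℝ V x‖ₑ ^ 2 ≤
      2 * (16 * La ^ 2 * ‖fderiv ℝ v (a x)‖ₑ ^ 2 + 9 * Lb ^ 2 * ‖fderiv ℝ v (b x)‖ₑ ^ 2) := by
    intro x hx
    rw [hVder, if_pos hx]
    have h4 : ‖(4 : ℝ)‖ₑ = 4 := by
      rw [Real.enorm_eq_ofReal (by norm_num)]; norm_num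
    have h3 : ‖(3 : ℝ)‖ₑ = 3 := by
      rw [Real.enorm_eq_ofReal (by norm_num)]; norm_num
    calc _ ≤ (4 * (La * ‖fderiv ℝ v (a x)‖ₑ) + 3 * (Lb * ‖fderiv ℝ v (b x)‖ₑ)) ^ 2 := by
          refine pow_le_pow_left' ((enorm_sub_le).trans ?_) 2
          rw [enorm_smul, enorm_smul, h4, h3]
          exact add_le_add (mul_le_mul_right (hcomp a La hLa x) _)
            (mul_le_mul_right (hcomp b Lb hLb x) _)
      _ ≤ _ := by
          refine (ENNReal.add_sq_le_two_mul _ _).trans (le_of_eq ?_)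
          ring
  set D := ∫⁻ x in {x | g x < 0}, ‖fderiv ℝ v x‖ₑ ^ 2 with hD
  have hmneg : MeasurableSet {x | g x < 0} := (isOpen_lt hg continuous_const).measurableSet
  have hmpos : MeasurableSet {x | 0 < g x} := (isOpen_lt continuous_const hg).measurableSet
  have hIa : ∫⁻ x in {x | 0 < g x}, ‖fderiv ℝ v (a x)‖ₑ ^ 2 ≤ 2 * D := by
    refine (setLIntegral_comp_graphReflection_le hN hγ (κ := 3 / 2) (κ' := 3) (by norm_num)
      (by norm_num) (fun y => ‖fderiv ℝ v y‖ₑ ^ 2)).trans (le_of_eq ?_)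
    congr 1
    norm_num
    rw [one_div, ENNReal.ofReal_inv_of_pos (by norm_num), inv_inv]
    norm_num
  have hIb : ∫⁻ x in {x | 0 < g x}, ‖fderiv ℝ v (b x)‖ₑ ^ 2 ≤ D := by
    refine (setLIntegral_comp_graphReflection_le hN hγ (κ := 2) (κ' := 2) (by norm_num)
      (by norm_num) (fun y => ‖fderiv ℝ v y‖ₑ ^ 2)).trans (le_of_eq ?_)
    norm_num
    rfl
  have hdv : Continuous (fderiv ℝ v) := hv.continuous_fderiv one_ne_zero
  have hIV : ∫⁻ x, ‖fderiv ℝ V x‖ₑ ^ 2 ≤ (1 + 2 * (16 * La ^ 2 * 2 + 9 * Lb ^ 2) : ℝ≥0) * D := by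
    have hle : ∀ᵐ x ∂(volume : Measure E), x ∈ {x | g x < 0} ∪ {x | 0 < g x} := by
      have h0 : ∀ᵐ x ∂(volume : Measure E), x ∉ {x | g x = 0} :=
        measure_eq_zero_iff_ae_notMem.1 (volume_graphHeight_eq_zero hN hg)
      filter_upwards [h0] with x hx
      exact lt_or_gt_of_ne hx
    calc ∫⁻ x, ‖fderiv ℝ V x‖ₑ ^ 2
        = ∫⁻ x in {x | g x < 0} ∪ {x | 0 < g x}, ‖fderiv ℝ V x‖ₑ ^ 2 := by
          rw [Measure.restrict_eq_self_of_ae_mem hle]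
      _ ≤ (∫⁻ x in {x | g x < 0}, ‖fderiv ℝ V x‖ₑ ^ 2) +
            ∫⁻ x in {x | 0 < g x}, ‖fderiv ℝ V x‖ₑ ^ 2 := lintegral_union_le _ _ _
      _ ≤ D + 2 * (16 * La ^ 2 * (2 * D) + 9 * Lb ^ 2 * D) := by
          refine add_le_add (le_of_eq ?_) ?_
          · refine setLIntegral_congr_fun hmneg fun x hx => ?_
            simp only [mem_ofPred_eq] at hx
            simp only [hVder, if_neg hx.not_gt]
          · refine (setLIntegral_mono' hmpos hpos).trans ?_
            rw [lintegral_const_mul' _ _ (by finiteness), lintegral_add_left,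
              lintegral_const_mul' _ _ (by finiteness), lintegral_const_mul' _ _ (by finiteness)]
            · gcongr
            · have : Continuous fun x => ‖fderiv ℝ v (a x)‖ₑ ^ 2 := by
                have := hac.continuous
                fun_prop
              exact this.measurable.const_mul _
      _ = _ := by
          push_cast
          ring
  calc eLpNorm v p (volume.restrict {x | g x < 0}) ^ 2
      = eLpNorm V p (volume.restrict {x | g x < 0}) ^ 2 := by
        congr 1
        refine eLpNorm_congr_ae ?_
        filter_upwards [ae_restrict_mem hmneg] with x hx
        have hx' : ¬ 0 < g x := not_lt.2 (le_of_lt hx)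
        simp [hV, hx']
    _ ≤ eLpNorm V p volume ^ 2 := by
        gcongr
        exact Measure.restrict_le_self
    _ ≤ C * ∫⁻ x, ‖fderiv ℝ V x‖ₑ ^ 2 := hC V hVC hVS
    _ ≤ _ := by
        rw [ENNReal.coe_mul, mul_assoc]
        exact mul_le_mul_right hIV _

end Reflection

section Sobolev

/-! ### The Sobolev inequality in exterior domains -/

variable {E : Type*} [NormedAddCommGroup E] [InnerProductSpace ℝ E]

/-- Near each of its boundary points, `Ω` is the region below the graph of a `C¹` function. -/
def HasC1GraphBoundary (Ω : Set E) : Prop :=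
  ∀ x₀ ∈ frontier Ω, ∃ (N : E) (γ : E → ℝ) (r : ℝ), ‖N‖ = 1 ∧ 0 < r ∧ ContDiff ℝ 1 γ ∧
    ∀ x ∈ Metric.ball x₀ r, x ∈ Ω ↔ graphHeight N γ x < 0

lemma exists_nnnorm_fderiv_contDiffBump_le [FiniteDimensional ℝ E] {x : E} (χ : ContDiffBump x) :
    ∃ M : ℝ≥0, ∀ y, ‖fderiv ℝ χ y‖₊ ≤ M := by
  have hχ : ContDiff ℝ 1 χ := χ.contDiff
  obtain ⟨M, hM⟩ := (hχ.continuous_fderiv one_ne_zero).bounded_above_of_compact_support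
    (χ.hasCompactSupport.fderiv ℝ)
  refine ⟨M.toNNReal, fun y => ?_⟩
  rw [← NNReal.coe_le_coe, coe_nnnorm]
  exact (hM y).trans (Real.le_coe_toNNReal M)

variable [FiniteDimensional ℝ E] [MeasurableSpace E] [BorelSpace E]

/-- A Poincaré inequality without mean value: functions of finite energy vanish at infinity. -/
lemma energyDominated_lintegral_sq_of_isCompact {Ω : Set E} (hΩ : IsOpen Ω) (hc : IsPreconnected Ω)
    (hb : Bornology.IsBounded Ωᶜ) (hn : 3 ≤ Module.finrank ℝ E) (hg : HasC1GraphBoundary Ω)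
    {K : Set E} (hK : IsCompact K) :
    EnergyDominated Ω (fun u => ∫⁻ y in K ∩ Ω, ‖u y‖ₑ ^ 2) := by
  have h := EnergyDominated.of_isCompact (Ω := Ω) (hK.inter_right isClosed_closure)
    (F := fun s u => ∫⁻ y in s ∩ Ω, ‖u y‖ₑ ^ 2) (c := 1) (by simp) (by simp)
    (fun u s t hst => lintegral_mono_set (inter_subset_inter_left _ hst))
    (fun u s t => by
      rw [union_inter_distrib_right, one_mul]
      exact lintegral_union_le _ _ _) (K := K ∩ closure Ω) ?_
  · refine h.mono fun u _ _ => lintegral_mono_set ?_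
    exact fun x hx => ⟨⟨hx.1, subset_closure hx.2⟩, hx.2⟩
  · rintro x ⟨-, hx⟩
    by_cases hxΩ : x ∈ Ω
    · obtain ⟨r, hr, h⟩ := energyDominated_ball_of_mem hΩ hc hb hn hxΩ
      exact ⟨r, hr, h.mono fun u _ _ => lintegral_mono_set inter_subset_left⟩
    · have hxf : x ∈ frontier Ω := by rw [hΩ.frontier_eq]; exact ⟨hx, hxΩ⟩
      obtain ⟨N, γ, r, hN, hr, hγ, hgr⟩ := hg x hxf
      exact energyDominated_ball_of_mem_frontier hΩ hc hb hn hN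
        (contDiff_graphHeight hγ).continuous hr hgr hxf

/-- The energy of `χ u` in `S` is controlled by the energy of `u` in `Ω`, if `χ` vanishes in
`S ∖ Ω` and the gradient of `χ` lives where the square integral of `u` is controlled. -/
lemma EnergyDominated.cutoff {Ω S T : Set E} (hΩ : MeasurableSet Ω) (hS : MeasurableSet S)
    (hT : MeasurableSet T) {χ : E → ℝ} (hχ : ContDiff ℝ 1 χ) (hχ1 : ∀ x, |χ x| ≤ 1) {M : ℝ≥0}
    (hM : ∀ x, ‖fderiv ℝ χ x‖₊ ≤ M) (hSΩ : ∀ x ∈ S, x ∈ tsupport χ → x ∈ Ω)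
    (hST : ∀ x ∈ S, x ∈ tsupport χ → fderiv ℝ χ x ≠ 0 → x ∈ T)
    (hdom : EnergyDominated Ω (fun u => ∫⁻ y in T ∩ Ω, ‖u y‖ₑ ^ 2)) :
    EnergyDominated Ω (fun u => ∫⁻ x in S, ‖fderiv ℝ (fun x => χ x * u x) x‖ₑ ^ 2) := by
  refine ((EnergyDominated.energy.add (hdom.const_mul (c := (M : ℝ≥0∞) ^ 2)
    (by finiteness))).const_mul (c := 2) (by finiteness)).mono fun u hu _ => ?_
  have hpt : ∀ x ∈ S, ‖fderiv ℝ (fun x => χ x * u x) x‖ₑ ^ 2 ≤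
      2 * (Ω.indicator (fun x => ‖fderiv ℝ u x‖ₑ ^ 2) x +
        M ^ 2 * (T ∩ Ω).indicator (fun x => ‖u x‖ₑ ^ 2) x) := by
    intro x hx
    by_cases hxt : x ∈ tsupport χ
    · have hxΩ := hSΩ x hx hxt
      rw [fderiv_fun_mul (hχ.differentiable one_ne_zero x) (hu.differentiable one_ne_zero x),
        indicator_of_mem hxΩ]
      have h1 : ‖χ x‖ₑ ≤ 1 := by
        rw [← ofReal_norm, Real.norm_eq_abs, ← ENNReal.ofReal_one]
        exact ENNReal.ofReal_le_ofReal (hχ1 x)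
      by_cases hd : fderiv ℝ χ x = 0
      · rw [hd, smul_zero, add_zero, enorm_smul]
        calc (‖χ x‖ₑ * ‖fderiv ℝ u x‖ₑ) ^ 2 ≤ (1 * ‖fderiv ℝ u x‖ₑ) ^ 2 := by gcongr
          _ ≤ 2 * ‖fderiv ℝ u x‖ₑ ^ 2 := by
            rw [one_mul]
            exact le_mul_of_one_le_left' (by norm_num)
          _ ≤ _ := by gcongr; exact le_self_add
      · rw [indicator_of_mem (show x ∈ T ∩ Ω from ⟨hST x hx hxt hd, hxΩ⟩), ← mul_pow]
        refine le_trans ?_ (ENNReal.add_sq_le_two_mul _ _)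
        refine pow_le_pow_left' ((enorm_add_le (χ x • fderiv ℝ u x) (u x • fderiv ℝ χ x)).trans
          (add_le_add ?_ ?_)) 2
        · rw [enorm_smul]
          exact mul_le_of_le_one_left' h1
        · rw [enorm_smul, mul_comm]
          gcongr
          exact ENNReal.coe_le_coe.2 (hM x)
    · have h0 : fderiv ℝ (fun x => χ x * u x) x = 0 := by
        refine image_eq_zero_of_notMem_tsupport fun h => hxt ?_
        exact (tsupport_mul_subset_left (f := χ) (g := u)) (tsupport_fderiv_subset ℝ h)
      rw [h0, ← ofReal_norm, norm_zero]
      simp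
  refine (setLIntegral_mono' hS hpt).trans ((setLIntegral_le_lintegral S _).trans (le_of_eq ?_))
  have hdu : Continuous fun x => ‖fderiv ℝ u x‖ₑ ^ 2 := by
    have := hu.continuous_fderiv one_ne_zero
    fun_prop
  rw [lintegral_const_mul' _ _ (by finiteness), lintegral_add_left (hdu.measurable.indicator hΩ),
    lintegral_const_mul' _ _ (by finiteness), lintegral_indicator hΩ,
    lintegral_indicator (hT.inter hΩ), dirichletEnergy]

lemma eLpNorm_restrict_union_le {X F : Type*} [MeasurableSpace X] [NormedAddCommGroup F]
    (μ : Measure X) (f : X → F) {p : ℝ≥0} (hp : 1 ≤ p) (s t : Set X) :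
    eLpNorm f p (μ.restrict (s ∪ t)) ≤ eLpNorm f p (μ.restrict s) + eLpNorm f p (μ.restrict t) := by
  have hp0 : p ≠ 0 := (zero_lt_one.trans_le hp).ne'
  simp only [eLpNorm_nnreal_eq_lintegral hp0]
  refine (ENNReal.rpow_le_rpow (lintegral_union_le _ s t) (by positivity)).trans ?_
  refine ENNReal.rpow_add_le_add_rpow _ _ (by positivity) ?_
  rw [div_le_one (by positivity)]
  exact_mod_cast hp

/-- The Sobolev inequality `‖u‖_{L^{2n/(n-2)}(Ω)} ≤ C ‖∇u‖_{L²(Ω)}` in exterior domains. -/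
theorem energyDominated_eLpNorm_sq {p : ℝ≥0} {Ω : Set E} (hΩ : IsOpen Ω) (hc : IsPreconnected Ω)
    (hb : Bornology.IsBounded Ωᶜ) (hn : 3 ≤ Module.finrank ℝ E) (hg : HasC1GraphBoundary Ω)
    (hp1 : 1 ≤ p) (hp : (p : ℝ)⁻¹ = 2⁻¹ - (Module.finrank ℝ E : ℝ)⁻¹) :
    EnergyDominated Ω (fun u => eLpNorm u p (volume.restrict Ω) ^ 2) := by
  have hE : 0 < Module.finrank ℝ E := by omega
  have hΩm := hΩ.measurableSet
  have hL2 := fun (K : Set E) (hK : IsCompact K) =>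
    energyDominated_lintegral_sq_of_isCompact hΩ hc hb hn hg hK
  -- a function `χ u` supported in `Ω` is handled by the inequality on the whole space
  have hwhole : ∀ (χ : E → ℝ) (K : Set E), IsCompact K → ContDiff ℝ 1 χ → (∀ x, |χ x| ≤ 1) →
      (∃ M : ℝ≥0, ∀ x, ‖fderiv ℝ χ x‖₊ ≤ M) → tsupport χ ⊆ Ω → (∀ x, fderiv ℝ χ x ≠ 0 → x ∈ K) →
      ∀ s, MeasurableSet s → (∀ x ∈ s, χ x = 1) →
      EnergyDominated Ω (fun u => eLpNorm u p (volume.restrict s) ^ 2) := by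
    rintro χ K hK hχ hχ1 ⟨M, hM⟩ hsub hKχ s hs hs1
    obtain ⟨C, hC⟩ := exists_eLpNorm_sq_le_lintegral_fderiv (E := E) hE hp
    have hcut := EnergyDominated.cutoff (S := univ) hΩm MeasurableSet.univ hK.measurableSet
      hχ hχ1 hM (fun x _ hx => hsub hx) (fun x _ _ hx => hKχ x hx) (hL2 K hK)
    refine (hcut.const_mul (c := C) (by simp)).mono fun u hu hsu => ?_
    have h1 : eLpNorm u p (volume.restrict s) ≤ eLpNorm (fun x => χ x * u x) p volume := by
      refine le_trans (le_of_eq ?_) (eLpNorm_mono_measure _ (Measure.restrict_le_self (s := s)))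
      refine eLpNorm_congr_ae ?_
      filter_upwards [ae_restrict_mem hs] with x hx
      simp [hs1 x hx]
    refine (pow_le_pow_left' h1 2).trans ?_
    have := hC (fun x => χ x * u x) (hχ.mul hu) (hsu.mul_left (f := χ))
    simpa using this
  have hbump1 : ∀ {x : E} (χ : ContDiffBump x) (y : E), |χ y| ≤ 1 := fun χ y => by
    rw [abs_of_nonneg χ.nonneg]; exact χ.le_one
  have hbumpd : ∀ {x : E} (χ : ContDiffBump x) (y : E), fderiv ℝ χ y ≠ 0 →
      y ∈ Metric.closedBall x χ.rOut := fun χ y hy => by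
    rw [← χ.tsupport_eq]
    exact tsupport_fderiv_subset ℝ (subset_tsupport _ hy)
  -- the inequality on bounded parts of `Ω`
  have hcpt : ∀ K : Set E, IsCompact K →
      EnergyDominated Ω (fun u => eLpNorm u p (volume.restrict (K ∩ Ω)) ^ 2) := by
    intro K hK
    have h := EnergyDominated.of_isCompact (Ω := Ω) (hK.inter_right isClosed_closure)
      (F := fun s u => eLpNorm u p (volume.restrict (s ∩ Ω)) ^ 2) (c := 2) (by simp) (by simp)
      (fun u s t hst => by
        gcongr)
      (fun u s t => by
        rw [union_inter_distrib_right]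
        exact (pow_le_pow_left' (eLpNorm_restrict_union_le _ u hp1 _ _) 2).trans
          (ENNReal.add_sq_le_two_mul _ _)) (K := K ∩ closure Ω) ?_
    · refine h.mono fun u _ _ => ?_
      refine pow_le_pow_left' (eLpNorm_mono_measure _ (Measure.restrict_mono ?_ le_rfl)) 2
      exact fun x hx => ⟨⟨hx.1, subset_closure hx.2⟩, hx.2⟩
    · rintro x ⟨-, hx⟩
      by_cases hxΩ : x ∈ Ω
      · obtain ⟨r, hr, hball⟩ := Metric.isOpen_iff.1 hΩ x hxΩ
        let χ : ContDiffBump x := ⟨r / 4, r / 2, by positivity, by linarith⟩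
        refine ⟨r / 4, by positivity, hwhole χ _ (isCompact_closedBall x (r / 2)) χ.contDiff
          (hbump1 χ) (exists_nnnorm_fderiv_contDiffBump_le χ) ?_ (hbumpd χ) _
          (measurableSet_ball.inter hΩm) fun y hy => ?_⟩
        · rw [χ.tsupport_eq]
          exact (Metric.closedBall_subset_ball (by simp only [χ]; linarith)).trans hball
        · exact χ.one_of_mem_closedBall (Metric.ball_subset_closedBall hy.1)
      · have hxf : x ∈ frontier Ω := by rw [hΩ.frontier_eq]; exact ⟨hx, hxΩ⟩
        obtain ⟨N, γ, r, hN, hr, hγ, hgr⟩ := hg x hxf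
        let χ : ContDiffBump x := ⟨r / 4, r / 2, by positivity, by linarith⟩
        obtain ⟨M, hM⟩ := exists_nnnorm_fderiv_contDiffBump_le χ
        obtain ⟨C, hC⟩ := exists_eLpNorm_sq_le_lintegral_fderiv_below_graph (E := E) hE hp hN hγ
          (isCompact_closedBall x (r / 2))
        have hm : MeasurableSet {x | graphHeight N γ x < 0} :=
          (isOpen_lt (contDiff_graphHeight hγ).continuous continuous_const).measurableSet
        have hχball : tsupport χ ⊆ Metric.ball x r := by
          rw [χ.tsupport_eq]
          exact Metric.closedBall_subset_ball (by simp only [χ]; linarith)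
        have hcut := EnergyDominated.cutoff (Ω := Ω) hΩm hm Metric.isClosed_closedBall.measurableSet
          χ.contDiff (hbump1 χ) hM (fun y hy hy' => (hgr y (hχball hy')).2 hy)
          (fun y _ _ hy => hbumpd χ y hy) (hL2 _ (isCompact_closedBall x χ.rOut))
        refine ⟨r / 4, by positivity, (hcut.const_mul (c := C) (by simp)).mono fun u hu hsu => ?_⟩
        have h1 : eLpNorm u p (volume.restrict (Metric.ball x (r / 4) ∩ Ω)) ≤
            eLpNorm (fun x => χ x * u x) p (volume.restrict {x | graphHeight N γ x < 0}) := by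
          refine le_trans (le_of_eq ?_) (eLpNorm_mono_measure _ (Measure.restrict_mono
            (s := Metric.ball x (r / 4) ∩ Ω) (fun y hy => (hgr y ?_).1 hy.2) le_rfl))
          · refine eLpNorm_congr_ae ?_
            filter_upwards [ae_restrict_mem (measurableSet_ball.inter hΩm)] with y hy
            rw [χ.one_of_mem_closedBall (Metric.ball_subset_closedBall hy.1), one_mul]
          · exact Metric.ball_subset_ball (by linarith) hy.1
        refine (pow_le_pow_left' h1 2).trans ?_
        refine hC (fun x => χ x * u x) (χ.contDiff.mul hu) ?_
        refine (tsupport_mul_subset_left (f := χ) (g := u)).trans ?_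
        rw [χ.tsupport_eq]
  obtain ⟨r₀, hr₀⟩ := hb.subset_ball 0
  set r : ℝ := max r₀ 1
  have hr : 0 < r := by positivity
  let χ : ContDiffBump (0 : E) := ⟨r, r + 1, hr, by linarith⟩
  have hsupp : tsupport (fun x => 1 - χ x) ⊆ {x | r ≤ ‖x‖} := by
    refine closure_minimal (fun x hx => ?_) (isClosed_le continuous_const continuous_norm)
    by_contra h
    apply hx
    simp only [mem_ofPred_eq, not_le] at h
    refine sub_eq_zero.2 (χ.one_of_mem_closedBall ?_).symm
    rw [mem_closedBall_zero_iff]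
    exact h.le
  have hfd : ∀ x, fderiv ℝ (fun x => 1 - χ x) x = - fderiv ℝ χ x := fun x => by
    rw [fderiv_const_sub]
  have hext := hwhole (fun x => 1 - χ x) (Metric.closedBall 0 (r + 1)) (isCompact_closedBall _ _)
    (contDiff_const.sub χ.contDiff)
    (fun x => abs_le.2 ⟨by linarith [χ.le_one (x := x)], by linarith [χ.nonneg (x := x)]⟩)
    (by
      obtain ⟨M, hM⟩ := exists_nnnorm_fderiv_contDiffBump_le χ
      refine ⟨M, fun x => ?_⟩
      rw [hfd, nnnorm_neg]
      exact hM x)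
    (hsupp.trans fun x (hx : r ≤ ‖x‖) => by
      by_contra h
      have := hr₀ h
      rw [mem_ball_zero_iff] at this
      linarith [le_max_left r₀ 1])
    (fun x hx => by
      rw [hfd] at hx
      exact hbumpd χ x (neg_ne_zero.1 hx))
    {x | r + 1 ≤ ‖x‖} (isClosed_le continuous_const continuous_norm).measurableSet
    (fun x (hx : r + 1 ≤ ‖x‖) => by
      rw [χ.zero_of_le_dist, sub_zero]
      rwa [dist_zero_right])
  refine (((hcpt _ (isCompact_closedBall 0 (r + 1))).add hext).const_mul (c := 2)
    (by simp)).mono fun u _ _ => ?_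
  refine le_trans ?_ (ENNReal.add_sq_le_two_mul _ _)
  refine pow_le_pow_left' (le_trans ?_ (eLpNorm_restrict_union_le _ u hp1 _ _)) 2
  refine eLpNorm_mono_measure _ (Measure.restrict_mono (fun x hx => ?_) le_rfl)
  rcases le_total (r + 1) ‖x‖ with h | h
  · exact Or.inr h
  · exact Or.inl ⟨mem_closedBall_zero_iff.2 h, hx⟩

end Sobolev

section Trace

variable {E : Type*} [NormedAddCommGroup E] [InnerProductSpace ℝ E]

/-! ### The trace inequality -/

/-- The component of `x` orthogonal to the unit vector `N`. -/
def perpComponent {N : E} (hN : ‖N‖ = 1) (x : E) : (ℝ ∙ N)ᗮ :=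
  ⟨x - inner ℝ N x • N, by
    rw [Submodule.mem_orthogonal_singleton_iff_inner_right, inner_sub_right, inner_smul_right,
      real_inner_self_eq_norm_sq, hN]
    ring⟩

lemma inner_perp_eq_zero {N : E} (y : (ℝ ∙ N)ᗮ) : inner ℝ N (y : E) = 0 :=
  Submodule.mem_orthogonal_singleton_iff_inner_right.1 y.2

lemma inner_perp_add_smul {N : E} (hN : ‖N‖ = 1) (y : (ℝ ∙ N)ᗮ) (t : ℝ) :
    inner ℝ N ((y : E) + t • N) = t := by
  rw [inner_add_right, inner_perp_eq_zero, inner_smul_right, real_inner_self_eq_norm_sq, hN]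
  ring

lemma continuous_perpComponent {N : E} (hN : ‖N‖ = 1) : Continuous (perpComponent hN) := by
  unfold perpComponent
  fun_prop

/-- The splitting of the space into `N^⊥` and the line spanned by the unit vector `N`. -/
def perpProdEquiv [FiniteDimensional ℝ E] {N : E} (hN : ‖N‖ = 1) : ((ℝ ∙ N)ᗮ × ℝ) ≃L[ℝ] E :=
  LinearEquiv.toContinuousLinearEquiv
    { toFun := fun z => (z.1 : E) + z.2 • N
      invFun := fun x => (perpComponent hN x, inner ℝ N x)
      map_add' := fun z w => by
        simp only [Prod.fst_add, Prod.snd_add, Submodule.coe_add]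
        module
      map_smul' := fun c z => by
        simp only [Prod.smul_fst, Prod.smul_snd, Submodule.coe_smul, RingHom.id_apply, smul_eq_mul]
        module
      left_inv := fun z => by
        refine Prod.ext (Subtype.ext ?_) (inner_perp_add_smul hN _ _)
        simp only [perpComponent, inner_perp_add_smul hN]
        abel
      right_inv := fun x => by simp [perpComponent] }

/-- The parametrization over `N^⊥` of the graph of `γ`. -/
def graphMap (N : E) (γ : E → ℝ) (y : (ℝ ∙ N)ᗮ) : E := (y : E) + γ y • N

lemma graphMap_perpComponent {N : E} (hN : ‖N‖ = 1) {γ : E → ℝ} {x : E}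
    (hx : graphHeight N γ x = 0) : graphMap N γ (perpComponent hN x) = x := by
  rw [graphHeight, sub_eq_zero] at hx
  simp [graphMap, perpComponent, ← hx]

lemma contDiff_graphMap {N : E} {γ : E → ℝ} (hγ : ContDiff ℝ 1 γ) :
    ContDiff ℝ 1 (graphMap N γ) := by
  have h : ContDiff ℝ 1 (fun y : (ℝ ∙ N)ᗮ => (y : E)) := ((ℝ ∙ N)ᗮ).subtypeL.contDiff
  exact h.add ((hγ.comp h).smul contDiff_const)

variable [FiniteDimensional ℝ E] [MeasurableSpace E] [BorelSpace E]

/-- The surface measure on a Lipschitz image is dominated by the image measure. -/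
lemma LipschitzOnWith.restrict_image_euclideanHausdorffMeasure_le {X Y : Type*} [MetricSpace X]
    [MeasurableSpace X] [BorelSpace X] [MetricSpace Y] [MeasurableSpace Y] [BorelSpace Y]
    {f : X → Y} {L : ℝ≥0} {D : Set X} {s : Set Y} (hf : LipschitzOnWith L f D)
    (hfm : Measurable f) (hs : s ⊆ f '' D) (d : ℕ) :
    (Measure.euclideanHausdorffMeasure d : Measure Y).restrict s ≤
      (L : ℝ≥0∞) ^ d • Measure.map f ((Measure.euclideanHausdorffMeasure d).restrict D) := by
  refine Measure.le_iff.2 fun A hA => ?_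
  rw [Measure.restrict_apply hA, Measure.smul_apply, Measure.map_apply hfm hA,
    Measure.restrict_apply (hfm hA), smul_eq_mul]
  have hsub : A ∩ s ⊆ f '' (f ⁻¹' A ∩ D) := by
    rintro y ⟨hyA, hys⟩
    obtain ⟨x, hx, rfl⟩ := hs hys
    exact ⟨x, ⟨hyA, hx⟩, rfl⟩
  refine (measure_mono hsub).trans ?_
  have h := (hf.mono (inter_subset_right (s := f ⁻¹' A))).hausdorffMeasure_image_le
    (d := d) (by positivity)
  rw [Measure.euclideanHausdorffMeasure_def, Measure.euclideanHausdorffMeasure_def,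
    Measure.smul_apply, Measure.smul_apply, ENNReal.smul_def, ENNReal.smul_def, smul_eq_mul,
    smul_eq_mul, mul_left_comm]
  refine mul_le_mul_right ?_ _
  simpa using h

lemma exists_lintegral_perp_eq {N : E} (hN : ‖N‖ = 1) :
    ∃ c : ℝ≥0, ∀ F : E → ℝ≥0∞, Measurable F →
      ∫⁻ y : (ℝ ∙ N)ᗮ, ∫⁻ t : ℝ, F (y + t • N)
        ∂volume ∂(Measure.euclideanHausdorffMeasure (Module.finrank ℝ E - 1)) =
      c * ∫⁻ x, F x := by
  have hfin : Module.finrank ℝ (ℝ ∙ N)ᗮ = Module.finrank ℝ E - 1 := by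
    have h1 := (ℝ ∙ N).finrank_add_finrank_orthogonal
    rw [finrank_span_singleton (by rw [← norm_ne_zero_iff, hN]; exact one_ne_zero)] at h1
    omega
  have : (Measure.euclideanHausdorffMeasure (Module.finrank ℝ E - 1) :
      Measure (ℝ ∙ N)ᗮ).IsAddHaarMeasure := by
    rw [← hfin]
    infer_instance
  set μ : Measure (ℝ ∙ N)ᗮ := Measure.euclideanHausdorffMeasure (Module.finrank ℝ E - 1)
  have : (Measure.map (perpProdEquiv hN) (μ.prod (volume : Measure ℝ))).IsAddHaarMeasure :=
    (perpProdEquiv hN).isAddHaarMeasure_map _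
  have hsmul := Measure.isAddLeftInvariant_eq_smul
    (Measure.map (perpProdEquiv hN) (μ.prod (volume : Measure ℝ))) (volume : Measure E)
  have hTm : Measurable (perpProdEquiv hN) := (perpProdEquiv hN).continuous.measurable
  refine ⟨(Measure.map (perpProdEquiv hN) (μ.prod (volume : Measure ℝ))).addHaarScalarFactor volume,
    fun F hF => ?_⟩
  have h1 := congrArg (fun m => ∫⁻ x, F x ∂m) hsmul
  simp only [lintegral_smul_measure, ENNReal.smul_def] at h1
  have h2 := lintegral_prod (μ := μ) (ν := (volume : Measure ℝ))
    (fun z => F (perpProdEquiv hN z)) (hF.comp hTm).aemeasurable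
  rw [lintegral_map hF hTm, h2] at h1
  exact h1

/-- Near a boundary point, the integral over the boundary is estimated by integrating along the
segments of fixed length that enter `Ω` in the graph direction. -/
lemma energyDominated_trace_ball {Ω : Set E} (hΩ : IsOpen Ω) {N : E} (hN : ‖N‖ = 1) {γ : E → ℝ}
    (hγ : ContDiff ℝ 1 γ) {x₀ : E} {r : ℝ} (hr : 0 < r)
    (hΩg : ∀ x ∈ Metric.ball x₀ r, x ∈ Ω ↔ graphHeight N γ x < 0)
    (hL2 : EnergyDominated Ω (fun u => ∫⁻ y in Metric.ball x₀ r ∩ Ω, ‖u y‖ₑ ^ 2)) :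
    ∃ ρ > 0, EnergyDominated Ω (fun u => (∫⁻ x in Metric.ball x₀ ρ ∩ frontier Ω, ‖u x‖ₑ
      ∂(Measure.euclideanHausdorffMeasure (Module.finrank ℝ E - 1))) ^ 2) := by
  set d := Module.finrank ℝ E - 1
  have hgc : Continuous (graphHeight N γ) := (contDiff_graphHeight hγ).continuous
  obtain ⟨L, t, ht, hLip⟩ := (contDiff_graphMap (N := N) hγ).contDiffAt.exists_lipschitzOnWith
    (x := perpComponent hN x₀)
  obtain ⟨ρ₀, hρ₀, hρt⟩ := Metric.mem_nhds_iff.1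
    ((continuous_perpComponent hN).continuousAt.preimage_mem_nhds ht)
  obtain ⟨c, hc⟩ := exists_lintegral_perp_eq hN
  refine ⟨min ρ₀ (r / 2), by positivity, ?_⟩
  set ρ := min ρ₀ (r / 2)
  set δ := r / 2 with hδ
  have hδ0 : 0 < δ := by positivity
  set s := Metric.ball x₀ ρ ∩ frontier Ω with hs
  have hsm : MeasurableSet s := measurableSet_ball.inter isClosed_frontier.measurableSet
  set Ψ := graphMap N γ with hΨ
  have hΨc : Continuous Ψ := (contDiff_graphMap hγ).continuous
  have hs0 : ∀ x ∈ s, graphHeight N γ x = 0 := fun x hx =>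
    graphHeight_eq_zero_of_mem_frontier hgc hΩg
      (Metric.ball_subset_ball ((min_le_right _ _).trans (by linarith)) hx.1) hx.2
  set D := Ψ ⁻¹' s ∩ t with hD
  have hsD : s ⊆ Ψ '' D := by
    intro x hx
    have h1 := graphMap_perpComponent hN (hs0 x hx)
    refine ⟨perpComponent hN x, ⟨?_, hρt (Metric.ball_subset_ball (min_le_left _ _) hx.1)⟩, h1⟩
    rw [mem_preimage, hΨ, h1]
    exact hx
  set B := Metric.ball x₀ r ∩ Ω with hB
  have hBm : MeasurableSet B := measurableSet_ball.inter hΩ.measurableSet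
  have hin : ∀ x ∈ s, ∀ τ ∈ Ioc 0 δ, x + τ • (-N) ∈ B := by
    intro x hx τ hτ
    have hball : x + τ • (-N) ∈ Metric.ball x₀ r := by
      have h1 := Metric.ball_subset_ball (min_le_right _ _) hx.1
      rw [mem_ball_iff_norm] at h1 ⊢
      rw [show x + τ • (-N) - x₀ = (x - x₀) + τ • (-N) by abel]
      refine (norm_add_le _ _).trans_lt ?_
      rw [norm_smul, norm_neg, hN, Real.norm_of_nonneg hτ.1.le]
      linarith [hτ.2]
    refine ⟨hball, (hΩg _ hball).2 ?_⟩
    rw [smul_neg, ← neg_smul, graphHeight_add_smul hN, hs0 x hx]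
    linarith [hτ.1]
  have hvolB : volume B ≠ ⊤ := ((measure_mono inter_subset_left).trans_lt measure_ball_lt_top).ne
  refine ((hL2.add (EnergyDominated.energy.const_mul (c := ENNReal.ofReal δ ^ 2)
    (by finiteness))).const_mul
    (c := ((ENNReal.ofReal δ)⁻¹ * ((L : ℝ≥0∞) ^ d * c)) ^ 2 * (volume B * 2)) ?_).mono
      fun u hu hsu => ?_
  · have : ENNReal.ofReal δ ≠ 0 := by simpa using hδ0
    have h2 : (ENNReal.ofReal δ)⁻¹ ≠ ⊤ := ENNReal.inv_ne_top.2 this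
    exact ENNReal.mul_ne_top (ENNReal.pow_ne_top (ENNReal.mul_ne_top h2 (by finiteness)))
      (ENNReal.mul_ne_top hvolB (by finiteness))
  have huc := hu.continuous
  have hdc := hu.continuous_fderiv one_ne_zero
  set w : E → ℝ≥0∞ := fun x => ‖u x‖ₑ + ENNReal.ofReal δ * ‖fderiv ℝ u x‖ₑ with hw
  have hwm : Measurable w := by
    have h1 : Continuous fun x => ‖u x‖ₑ := by fun_prop
    have h2 : Continuous fun x => ‖fderiv ℝ u x‖ₑ := by fun_prop
    exact h1.measurable.add (h2.measurable.const_mul _)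
  have hseg : ∀ x, ‖u x‖ₑ ≤ (ENNReal.ofReal δ)⁻¹ * ∫⁻ τ in Ioc 0 δ, w (x + τ • (-N)) := by
    intro x
    have hδe : ENNReal.ofReal δ ≠ 0 := by simpa using hδ0
    suffices h : ‖u x‖ₑ * ENNReal.ofReal δ ≤ ∫⁻ τ in Ioc 0 δ, w (x + τ • (-N)) by
      rw [mul_comm, ← div_eq_mul_inv]
      exact ENNReal.le_div_iff_mul_le (Or.inl hδe) (Or.inl ENNReal.ofReal_ne_top) |>.2 h
    set I := ∫⁻ τ in Ioc 0 δ, ‖fderiv ℝ u (x + τ • (-N))‖ₑ with hI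
    have h1 : ∀ τ ∈ Ioc 0 δ, ‖u x‖ₑ ≤ ‖u (x + τ • (-N))‖ₑ + I := by
      intro τ hτ
      have h2 := enorm_sub_le_lintegral_fderiv hu x (-N) hτ.1.le
      have hNe : ‖-N‖ₑ = 1 := by rw [← ofReal_norm, norm_neg, hN, ENNReal.ofReal_one]
      rw [zero_smul, add_zero, hNe, one_mul] at h2
      calc ‖u x‖ₑ = ‖u (x + τ • (-N)) - (u (x + τ • (-N)) - u x)‖ₑ := by congr 1; ring
        _ ≤ ‖u (x + τ • (-N))‖ₑ + ‖u (x + τ • (-N)) - u x‖ₑ := enorm_sub_le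
        _ ≤ _ := by
          gcongr
          exact h2.trans (lintegral_mono_set (Ioc_subset_Ioc_right hτ.2))
    have h3 : Continuous fun τ : ℝ => ‖u (x + τ • (-N))‖ₑ := by fun_prop
    calc ‖u x‖ₑ * ENNReal.ofReal δ = ∫⁻ τ in Ioc 0 δ, ‖u x‖ₑ := by simp
      _ ≤ ∫⁻ τ in Ioc 0 δ, (‖u (x + τ • (-N))‖ₑ + I) := setLIntegral_mono' measurableSet_Ioc h1
      _ = (∫⁻ τ in Ioc 0 δ, ‖u (x + τ • (-N))‖ₑ) + ENNReal.ofReal δ * I := by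
        rw [lintegral_add_left h3.measurable]
        simp [mul_comm]
      _ = _ := by
        rw [hI, ← lintegral_const_mul' _ _ (by finiteness), ← lintegral_add_left h3.measurable]
  have hmain : ∫⁻ x in s, ‖u x‖ₑ ∂(Measure.euclideanHausdorffMeasure d) ≤
      ((ENNReal.ofReal δ)⁻¹ * ((L : ℝ≥0∞) ^ d * c)) * ∫⁻ x in B, w x := by
    have hΦm : Measurable fun x : E => ∫⁻ τ in Ioc 0 δ, B.indicator w (x + τ • (-N)) := by
      refine Measurable.lintegral_prod_right' (f := fun z : E × ℝ =>
        B.indicator w (z.1 + z.2 • (-N))) ?_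
      exact (hwm.indicator hBm).comp (by fun_prop)
    calc ∫⁻ x in s, ‖u x‖ₑ ∂(Measure.euclideanHausdorffMeasure d)
        ≤ ∫⁻ x in s, ((ENNReal.ofReal δ)⁻¹ *
            ∫⁻ τ in Ioc 0 δ, B.indicator w (x + τ • (-N))) ∂(Measure.euclideanHausdorffMeasure d) := by
          refine setLIntegral_mono' hsm fun x hx => (hseg x).trans (le_of_eq ?_)
          congr 1
          refine setLIntegral_congr_fun measurableSet_Ioc fun τ hτ => ?_
          simp only [indicator_of_mem (hin x hx τ hτ)]
      _ ≤ (L : ℝ≥0∞) ^ d * ∫⁻ y in D, ((ENNReal.ofReal δ)⁻¹ *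
            ∫⁻ τ in Ioc 0 δ, B.indicator w (Ψ y + τ • (-N)))
            ∂(Measure.euclideanHausdorffMeasure d) := by
          refine (lintegral_mono' ((hLip.mono
            inter_subset_right).restrict_image_euclideanHausdorffMeasure_le hΨc.measurable hsD d)
            le_rfl).trans (le_of_eq ?_)
          rw [lintegral_smul_measure, lintegral_map (hΦm.const_mul _) hΨc.measurable, smul_eq_mul]
      _ ≤ (L : ℝ≥0∞) ^ d * ∫⁻ y : (ℝ ∙ N)ᗮ, ((ENNReal.ofReal δ)⁻¹ *
            ∫⁻ τ : ℝ, B.indicator w (y + τ • N))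
            ∂(Measure.euclideanHausdorffMeasure d) := by
          refine mul_le_mul_right ((setLIntegral_le_lintegral D _).trans
            (lintegral_mono fun y => mul_le_mul_right
              ((setLIntegral_le_lintegral _ _).trans (le_of_eq ?_)) _)) _
          rw [← lintegral_sub_left_eq_self (fun τ => B.indicator w (y + τ • N)) (γ y)]
          refine lintegral_congr fun τ => ?_
          congr 1
          rw [hΨ, graphMap]
          module
      _ = _ := by
          have hδe : (ENNReal.ofReal δ)⁻¹ ≠ ⊤ := ENNReal.inv_ne_top.2 (by simpa using hδ0)
          rw [lintegral_const_mul' _ _ hδe, hc _ (hwm.indicator hBm), lintegral_indicator hBm]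
          ring
  refine (pow_le_pow_left' hmain 2).trans ?_
  rw [mul_pow, mul_assoc]
  refine mul_le_mul_right ((lintegral_sq_le_measure_mul _ hwm.aemeasurable).trans ?_) _
  rw [Measure.restrict_apply_univ, mul_assoc]
  refine mul_le_mul_right ?_ _
  have h1 : Continuous fun x => ‖u x‖ₑ ^ 2 := by fun_prop
  calc ∫⁻ x in B, w x ^ 2
      ≤ ∫⁻ x in B, 2 * (‖u x‖ₑ ^ 2 + ENNReal.ofReal δ ^ 2 * ‖fderiv ℝ u x‖ₑ ^ 2) := by
        refine lintegral_mono fun x => ?_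
        rw [← mul_pow]
        exact ENNReal.add_sq_le_two_mul _ _
    _ = 2 * ((∫⁻ x in B, ‖u x‖ₑ ^ 2) +
          ENNReal.ofReal δ ^ 2 * ∫⁻ x in B, ‖fderiv ℝ u x‖ₑ ^ 2) := by
        rw [lintegral_const_mul' _ _ (by finiteness), lintegral_add_left h1.measurable,
          lintegral_const_mul' _ _ (by finiteness)]
    _ ≤ _ := by
        gcongr
        exact lintegral_mono_set inter_subset_right

/-- The trace inequality `‖u‖_{L¹(∂Ω)} ≤ C ‖∇u‖_{L²(Ω)}` in exterior domains. -/
theorem energyDominated_trace {Ω : Set E} (hΩ : IsOpen Ω) (hc : IsPreconnected Ω)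
    (hb : Bornology.IsBounded Ωᶜ) (hn : 3 ≤ Module.finrank ℝ E) (hg : HasC1GraphBoundary Ω) :
    EnergyDominated Ω (fun u => (∫⁻ x in frontier Ω, ‖u x‖ₑ
      ∂(Measure.euclideanHausdorffMeasure (Module.finrank ℝ E - 1))) ^ 2) := by
  have hcpt : IsCompact (frontier Ω) := by
    rw [← frontier_compl]
    exact Metric.isCompact_of_isClosed_isBounded isClosed_frontier
      (hb.closure.subset frontier_subset_closure)
  have h := EnergyDominated.of_isCompact (Ω := Ω) hcpt
    (F := fun s u => (∫⁻ x in s ∩ frontier Ω, ‖u x‖ₑ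
      ∂(Measure.euclideanHausdorffMeasure (Module.finrank ℝ E - 1))) ^ 2) (c := 2) (by simp)
    (by simp) (fun u s t hst => pow_le_pow_left'
      (lintegral_mono_set (inter_subset_inter_left _ hst)) 2)
    (fun u s t => by
      rw [union_inter_distrib_right]
      exact (pow_le_pow_left' (lintegral_union_le _ _ _) 2).trans
        (ENNReal.add_sq_le_two_mul _ _)) fun x hx => ?_
  · simpa using h
  · obtain ⟨N, γ, r, hN, hr, hγ, hgr⟩ := hg x hx
    exact energyDominated_trace_ball hΩ hN hγ hr hgr
      ((energyDominated_lintegral_sq_of_isCompact hΩ hc hb hn hg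
        (isCompact_closedBall x r)).mono fun u _ _ =>
          lintegral_mono_set (inter_subset_inter_left _ Metric.ball_subset_closedBall))

end Trace

section Normal

variable {n : ℕ}

lemma IsExteriorDomain.hasC1GraphBoundary {α : ℝ≥0} {Ω : Set (EuclideanSpace ℝ (Fin n))}
    (hΩ : IsExteriorDomain α Ω) : HasC1GraphBoundary Ω := by
  intro x₀ hx₀
  obtain ⟨N, γ, r, hN, hr, hγ, -, h⟩ := hΩ.boundary x₀ hx₀
  refine ⟨N, γ, r, hN, hr, hγ.of_le (by norm_num), fun x hx => ?_⟩
  rw [h x hx, graphHeight, sub_neg]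

/-! ### The outward normal -/

lemma IsOuterUnitNormal.unique {Ω : Set (EuclideanSpace ℝ (Fin n))}
    {x ν ν' : EuclideanSpace ℝ (Fin n)} (h : IsOuterUnitNormal Ω x ν)
    (h' : IsOuterUnitNormal Ω x ν') : ν = ν' := by
  by_contra hne
  have h1 : inner ℝ ν' ν < 1 :=
    (inner_lt_one_iff_real_of_norm_eq_one h'.1 h.1).2 (Ne.symm hne)
  -- the direction `ν' - ν` would both enter and leave `Ω`
  have hin := h.2.1 (ν' - ν) (by
    rw [inner_sub_left, real_inner_self_eq_norm_sq, h.1]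
    linarith)
  have hout := h'.2.2 (ν' - ν) (by
    rw [inner_sub_left, real_inner_self_eq_norm_sq, h'.1, real_inner_comm]
    linarith)
  obtain ⟨t, ht, ht'⟩ := (hin.and hout).exists
  exact ht' ht

lemma IsOuterUnitNormal.outerNormal_eq {Ω : Set (EuclideanSpace ℝ (Fin n))}
    {x ν : EuclideanSpace ℝ (Fin n)} (h : IsOuterUnitNormal Ω x ν) : outerNormal Ω x = ν :=
  (Classical.epsilon_spec (p := IsOuterUnitNormal Ω x) ⟨ν, h⟩).unique h

lemma HasDerivAt.eventually_nhdsGT_lt_zero {f : ℝ → ℝ} {f' : ℝ} (hf : HasDerivAt f f' 0)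
    (h0 : f 0 = 0) (hf' : f' < 0) : ∀ᶠ t in 𝓝[>] 0, f t < 0 := by
  have h1 := (hasDerivAt_iff_tendsto_slope.1 hf).eventually_lt_const hf'
  filter_upwards [h1.filter_mono (nhdsWithin_mono 0 fun t (ht : 0 < t) => ht.ne'),
    self_mem_nhdsWithin] with t ht ht0
  have ht0' : (0 : ℝ) < t := ht0
  rw [slope_def_field, h0, sub_zero, sub_zero, div_neg_iff] at ht
  rcases ht with ⟨-, h⟩ | ⟨h, -⟩
  · linarith
  · exact h

lemma isOuterUnitNormal_gradient_graphHeight {Ω : Set (EuclideanSpace ℝ (Fin n))}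
    {N : EuclideanSpace ℝ (Fin n)} (hN : ‖N‖ = 1) {γ : EuclideanSpace ℝ (Fin n) → ℝ}
    (hγ : ContDiff ℝ 1 γ) {x₀ : EuclideanSpace ℝ (Fin n)} {r : ℝ}
    (hΩ : ∀ x ∈ Metric.ball x₀ r, x ∈ Ω ↔ graphHeight N γ x < 0) {x : EuclideanSpace ℝ (Fin n)}
    (hx : x ∈ Metric.ball x₀ r) (hx0 : graphHeight N γ x = 0) :
    IsOuterUnitNormal Ω x
      (‖gradient (graphHeight N γ) x‖⁻¹ • gradient (graphHeight N γ) x) := by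
  set G := gradient (graphHeight N γ) x with hG
  have hGv : ∀ v, inner ℝ G v = fderiv ℝ (graphHeight N γ) x v := fun v => by
    rw [hG, gradient, InnerProductSpace.toDual_symm_apply]
  have hG0 : 0 < ‖G‖ := by
    rw [norm_pos_iff]
    intro h
    have := hGv N
    rw [h, inner_zero_left, fderiv_graphHeight_apply_normal hN hγ] at this
    exact zero_ne_one this
  have hder : ∀ v, HasDerivAt (fun t : ℝ => graphHeight N γ (x + t • v)) (inner ℝ G v) 0 := by
    intro v
    have h1 : HasDerivAt (fun s : ℝ => x + s • v) v 0 := by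
      simpa using ((hasDerivAt_id (0 : ℝ)).smul_const v).const_add x
    have hd : DifferentiableAt ℝ (graphHeight N γ) (x + (0 : ℝ) • v) :=
      (contDiff_graphHeight hγ).differentiable one_ne_zero _
    have h2 := hd.hasFDerivAt.comp_hasDerivAt (0 : ℝ) h1
    rw [zero_smul, add_zero] at h2
    rw [hGv]
    exact h2
  have hball : ∀ v, ∀ᶠ t : ℝ in 𝓝[>] 0, x + t • v ∈ Metric.ball x₀ r := by
    intro v
    have hc : Continuous fun t : ℝ => x + t • v := by fun_prop
    have hmem : Metric.ball x₀ r ∈ 𝓝 (x + (0 : ℝ) • v) := by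
      rw [zero_smul, add_zero]
      exact Metric.isOpen_ball.mem_nhds hx
    exact (hc.continuousAt.eventually hmem).filter_mono nhdsWithin_le_nhds
  have hzero : ∀ v, graphHeight N γ (x + (0 : ℝ) • v) = 0 := fun v => by
    rw [zero_smul, add_zero, hx0]
  refine ⟨?_, fun v hv => ?_, fun v hv => ?_⟩
  · rw [norm_smul, norm_inv, norm_norm, inv_mul_cancel₀ hG0.ne']
  · rw [inner_smul_right, real_inner_comm] at hv
    have hv' : inner ℝ G v < 0 := by
      by_contra h
      exact absurd hv (not_lt.2 (mul_nonneg (by positivity) (not_lt.1 h)))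
    filter_upwards [(hder v).eventually_nhdsGT_lt_zero (hzero v) hv', hball v] with t ht ht'
    exact (hΩ _ ht').2 ht
  · rw [inner_smul_right, real_inner_comm] at hv
    have hv' : 0 < inner ℝ G v := by
      by_contra h
      exact absurd hv (not_lt.2 (mul_nonpos_of_nonneg_of_nonpos (by positivity) (not_lt.1 h)))
    filter_upwards [(hder v).neg.eventually_nhdsGT_lt_zero (by simpa using hzero v) (by linarith),
      hball v] with t ht ht'
    rw [hΩ _ ht']
    simp only [Pi.neg_apply] at ht
    linarith

lemma continuousOn_outerNormal {Ω : Set (EuclideanSpace ℝ (Fin n))} (hg : HasC1GraphBoundary Ω) :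
    ContinuousOn (outerNormal Ω) (frontier Ω) := by
  intro x₀ hx₀
  obtain ⟨N, γ, r, hN, hr, hγ, hΩ⟩ := hg x₀ hx₀
  have hgc := contDiff_graphHeight (N := N) hγ
  have heq : ∀ x ∈ Metric.ball x₀ r ∩ frontier Ω, outerNormal Ω x =
      ‖gradient (graphHeight N γ) x‖⁻¹ • gradient (graphHeight N γ) x := fun x hx =>
    (isOuterUnitNormal_gradient_graphHeight hN hγ hΩ hx.1
      (graphHeight_eq_zero_of_mem_frontier hgc.continuous hΩ hx.1 hx.2)).outerNormal_eq
  have hgrad : Continuous (gradient (graphHeight N γ)) :=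
    (InnerProductSpace.toDual ℝ _).symm.continuous.comp (hgc.continuous_fderiv one_ne_zero)
  have hx₀b := Metric.mem_ball_self (x := x₀) hr
  have hne : ‖gradient (graphHeight N γ) x₀‖ ≠ 0 := by
    intro h
    have h1 := (isOuterUnitNormal_gradient_graphHeight hN hγ hΩ hx₀b
      (graphHeight_eq_zero_of_mem_frontier hgc.continuous hΩ hx₀b hx₀)).1
    rw [h, norm_smul, h] at h1
    simp at h1
  have hc : ContinuousAt (fun x => ‖gradient (graphHeight N γ) x‖⁻¹ •
      gradient (graphHeight N γ) x) x₀ :=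
    (hgrad.norm.continuousAt.inv₀ hne).smul hgrad.continuousAt
  refine hc.continuousWithinAt.congr_of_eventuallyEq ?_ (heq x₀ ⟨hx₀b, hx₀⟩)
  filter_upwards [mem_nhdsWithin_of_mem_nhds (Metric.ball_mem_nhds x₀ hr), self_mem_nhdsWithin]
    with x hx hx'
  exact heq x ⟨hx, hx'⟩

lemma norm_outerNormal {Ω : Set (EuclideanSpace ℝ (Fin n))} (hg : HasC1GraphBoundary Ω)
    {x : EuclideanSpace ℝ (Fin n)} (hx : x ∈ frontier Ω) : ‖outerNormal Ω x‖ = 1 := by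
  obtain ⟨N, γ, r, hN, hr, hγ, hΩ⟩ := hg x hx
  have h := isOuterUnitNormal_gradient_graphHeight hN hγ hΩ (Metric.mem_ball_self hr)
    (graphHeight_eq_zero_of_mem_frontier (contDiff_graphHeight hγ).continuous hΩ
      (Metric.mem_ball_self hr) hx)
  rw [h.outerNormal_eq]
  exact h.1

/-! ### The energy norm on the energy space -/

lemma norm_gradient {F : Type*} [NormedAddCommGroup F] [InnerProductSpace ℝ F] [CompleteSpace F]
    (f : F → ℝ) (x : F) : ‖gradient f x‖ = ‖fderiv ℝ f x‖ := by
  rw [gradient, LinearIsometryEquiv.norm_map]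

/-- On the energy space, the values and the trace are controlled by the gradient. -/
theorem exists_norm_le_mul_norm_grad [Fact (3 ≤ n)] {α : ℝ≥0} {Ω : Set (EuclideanSpace ℝ (Fin n))}
    (hΩ : IsExteriorDomain α Ω) :
    ∃ C : ℝ, 0 ≤ C ∧ ∀ z ∈ energySpace Ω, ‖z.1‖ ≤ C * ‖z.2.1‖ ∧ ‖z.2.2‖ ≤ C * ‖z.2.1‖ := by
  have hn : 3 ≤ n := Fact.out
  have hn' : (3 : ℝ) ≤ n := by exact_mod_cast hn
  have hfin : Module.finrank ℝ (EuclideanSpace ℝ (Fin n)) = n := finrank_euclideanSpace_fin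
  set p : ℝ≥0 := Real.toNNReal (2 * n / (n - 2)) with hp
  have hpc : (p : ℝ) = 2 * n / (n - 2) :=
    Real.coe_toNNReal _ (div_nonneg (by positivity) (by linarith))
  have hp1 : 1 ≤ p := by
    rw [← NNReal.coe_le_coe, hpc, NNReal.coe_one, le_div_iff₀ (by linarith)]
    linarith
  have hpinv : (p : ℝ)⁻¹ = 2⁻¹ - (Module.finrank ℝ (EuclideanSpace ℝ (Fin n)) : ℝ)⁻¹ := by
    have h1 : (n : ℝ) - 2 ≠ 0 := by linarith
    have h2 : (n : ℝ) ≠ 0 := by linarith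
    rw [hpc, hfin]
    field_simp
  obtain ⟨C₁, hC₁⟩ := energyDominated_eLpNorm_sq hΩ.isOpen hΩ.isConnected.isPreconnected
    hΩ.isBounded_compl (by rw [hfin]; exact hn) hΩ.hasC1GraphBoundary hp1 hpinv
  obtain ⟨C₂, hC₂⟩ := energyDominated_trace hΩ.isOpen hΩ.isConnected.isPreconnected
    hΩ.isBounded_compl (by rw [hfin]; exact hn) hΩ.hasC1GraphBoundary
  rw [hfin] at hC₂
  set C : ℝ := Real.sqrt (max C₁ C₂) with hC
  have hCsq : C ^ 2 = max C₁ C₂ := Real.sq_sqrt (by positivity)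
  have hreal : ∀ (K : ℝ≥0) (a b : ℝ), 0 ≤ a → 0 ≤ b → (K : ℝ) ≤ max C₁ C₂ →
      ENNReal.ofReal a ^ 2 ≤ K * ENNReal.ofReal b ^ 2 → a ≤ C * b := by
    intro K a b ha hb hK h
    rw [← ENNReal.ofReal_pow ha, ← ENNReal.ofReal_pow hb, ← ENNReal.ofReal_coe_nnreal,
      ← ENNReal.ofReal_mul K.coe_nonneg, ENNReal.ofReal_le_ofReal_iff (by positivity)] at h
    refine abs_le_of_sq_le_sq' ?_ (by positivity) |>.2
    rw [mul_pow, hCsq]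
    exact h.trans (by gcongr)
  refine ⟨C, Real.sqrt_nonneg _, fun z hz => ?_⟩
  have hclosed : IsClosed {z : EnergyTriple Ω | ‖z.1‖ ≤ C * ‖z.2.1‖ ∧ ‖z.2.2‖ ≤ C * ‖z.2.1‖} :=
    IsClosed.and
      (isClosed_le (f := fun z : EnergyTriple Ω => ‖z.1‖) (g := fun z => C * ‖z.2.1‖)
        (by fun_prop) (by fun_prop))
      (isClosed_le (f := fun z : EnergyTriple Ω => ‖z.2.2‖) (g := fun z => C * ‖z.2.1‖)
        (by fun_prop) (by fun_prop))
  refine closure_minimal ?_ hclosed hz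
  rintro w ⟨φ, hφ, hsφ, h1, h2, h3⟩
  have hφ1 : ContDiff ℝ 1 φ := hφ.of_le (by exact_mod_cast le_top)
  have henergy : dirichletEnergy Ω φ = ENNReal.ofReal ‖w.2.1‖ ^ 2 := by
    rw [ofReal_norm, Lp.enorm_def, eLpNorm_congr_ae h2, eLpNorm_two_sq_eq_lintegral,
      dirichletEnergy]
    refine lintegral_congr fun x => ?_
    rw [← ofReal_norm, ← ofReal_norm, norm_gradient]
  constructor
  · refine hreal C₁ _ _ (norm_nonneg _) (norm_nonneg _) (le_max_left _ _) ?_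
    rw [← henergy, ofReal_norm, Lp.enorm_def, eLpNorm_congr_ae h1]
    exact hC₁ φ hφ1 hsφ
  · refine hreal C₂ _ _ (norm_nonneg _) (norm_nonneg _) (le_max_right _ _) ?_
    rw [← henergy, ofReal_norm, Lp.enorm_def, eLpNorm_congr_ae h3, eLpNorm_one_eq_lintegral_enorm]
    exact hC₂ φ hφ1 hsφ

end Normal

/-! ### Uniform convexity of the energy density -/

lemma second_order_lower_bound {f m m' : ℝ → ℝ} {κ : ℝ} (hf : ∀ t, HasDerivAt f (m t) t)
    (hm : ∀ t, HasDerivAt m (m' t) t) (hκ : ∀ t, κ ≤ m' t) : f 0 + m 0 + κ / 2 ≤ f 1 := by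
  have h1 : Monotone fun t => m t - κ * t := by
    refine monotone_of_hasDerivAt_nonneg (f' := fun t => m' t - κ) (fun t => ?_) fun t => by
      simpa using hκ t
    exact ((hm t).sub ((hasDerivAt_id t).const_mul κ)).congr_deriv (by simp)
  have hd : ∀ t, HasDerivAt (fun t => f t - m 0 * t - κ * t ^ 2 / 2) (m t - m 0 - κ * t) t := by
    intro t
    have h := ((hf t).sub ((hasDerivAt_id t).const_mul (m 0))).sub
      ((((hasDerivAt_id t).pow 2).const_mul κ).div_const 2)
    refine h.congr_deriv ?_
    simp
    ring
  have h2 : MonotoneOn (fun t => f t - m 0 * t - κ * t ^ 2 / 2) (Icc 0 1) := by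
    refine monotoneOn_of_deriv_nonneg (convex_Icc 0 1)
      (fun t _ => (hd t).continuousAt.continuousWithinAt)
      (fun t _ => (hd t).differentiableAt.differentiableWithinAt) fun t ht => ?_
    rw [interior_Icc] at ht
    rw [(hd t).deriv]
    have := h1 ht.1.le
    simp only [mul_zero, sub_zero] at this
    linarith
  have h3 := h2 (left_mem_Icc.2 zero_le_one) (right_mem_Icc.2 zero_le_one) zero_le_one
  norm_num at h3
  linarith

section Radial

variable {E : Type*} [NormedAddCommGroup E] [InnerProductSpace ℝ E]

/-- The function `P ↦ ½ ∫₀^{|P|²} r(v) dv`, whose gradient is `r(|P|²) P`. -/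
def radialPotential (r : ℝ → ℝ) (P : E) : ℝ := 1 / 2 * ∫ v in (0 : ℝ)..‖P‖ ^ 2, r v

variable {r : ℝ → ℝ}

lemma hasDerivAt_norm_sq_line (a d : E) (t : ℝ) :
    HasDerivAt (fun t : ℝ => ‖a + t • d‖ ^ 2) (2 * inner ℝ (a + t • d) d) t := by
  have h1 : HasDerivAt (fun t : ℝ => a + t • d) d t := by
    simpa using ((hasDerivAt_id t).smul_const d).const_add a
  exact h1.norm_sq

lemma hasDerivAt_radialPotential_line (hr : ContinuousOn r (Ici 0)) (a d : E) (t : ℝ) :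
    HasDerivAt (fun t : ℝ => radialPotential r (a + t • d))
      (r (‖a + t • d‖ ^ 2) * inner ℝ (a + t • d) d) t := by
  -- extend `r` continuously to negative arguments
  have hrc : Continuous fun v => r (max v 0) :=
    hr.comp_continuous (by fun_prop) fun v => le_max_right v 0
  have heq : ∀ P : E, radialPotential r P = 1 / 2 * ∫ v in (0 : ℝ)..‖P‖ ^ 2, r (max v 0) := by
    intro P
    rw [radialPotential]
    congr 1
    refine intervalIntegral.integral_congr fun v hv => ?_
    rw [uIcc_of_le (by positivity)] at hv
    simp only [max_eq_left hv.1]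
  have h1 := (intervalIntegral.integral_hasDerivAt_right (hrc.intervalIntegrable 0 (‖a + t • d‖ ^ 2))
    (hrc.stronglyMeasurableAtFilter _ _) hrc.continuousAt).comp t (hasDerivAt_norm_sq_line a d t)
  have h2 := h1.const_mul (1 / 2)
  simp only [heq]
  refine h2.congr_deriv ?_
  rw [max_eq_left (by positivity)]
  ring

lemma hasDerivAt_radial_flux_line (hr : ContDiffOn ℝ 1 r (Ici 0)) (a d : E) (t : ℝ) :
    HasDerivAt (fun t : ℝ => r (‖a + t • d‖ ^ 2) * inner ℝ (a + t • d) d)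
      (r (‖a + t • d‖ ^ 2) * ‖d‖ ^ 2 +
        2 * deriv r (‖a + t • d‖ ^ 2) * inner ℝ (a + t • d) d ^ 2) t := by
  set v := ‖a + t • d‖ ^ 2 with hv
  have hv0 : 0 ≤ v := by positivity
  have h1 : HasDerivWithinAt r (derivWithin r (Ici 0) v) (Ici 0) v :=
    ((hr.differentiableOn one_ne_zero) v hv0).hasDerivWithinAt
  have h2 : HasDerivAt (fun t : ℝ => r (‖a + t • d‖ ^ 2))
      (derivWithin r (Ici 0) v * (2 * inner ℝ (a + t • d) d)) t := by
    rw [← hasDerivWithinAt_univ]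
    exact HasDerivWithinAt.comp (h := fun t : ℝ => ‖a + t • d‖ ^ 2) t h1
      (hasDerivAt_norm_sq_line a d t).hasDerivWithinAt
      (fun s _ => (by positivity : (0 : ℝ) ≤ ‖a + s • d‖ ^ 2))
  have h3 : HasDerivAt (fun t : ℝ => inner ℝ (a + t • d) d) (‖d‖ ^ 2) t := by
    have h4 : HasDerivAt (fun t : ℝ => a + t • d) d t := by
      simpa using ((hasDerivAt_id t).smul_const d).const_add a
    have h5 := h4.inner ℝ (hasDerivAt_const t d)
    refine h5.congr_deriv ?_
    simp
  refine (h2.mul h3).congr_deriv ?_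
  -- the derivative at `v = 0` is only one-sided, but there its coefficient vanishes
  rcases hv0.eq_or_lt with h0 | h0
  · have : a + t • d = 0 := by
      rw [hv] at h0
      simpa using h0.symm
    simp [this, hv]
  · rw [derivWithin_of_mem_nhds (Ici_mem_nhds h0)]
    ring

lemma radialPotential_lower_bound (hr : ContDiffOn ℝ 1 r (Ici 0)) {c : ℝ}
    (hc : ∀ P ξ : E, c * ‖ξ‖ ^ 2 ≤
      r (‖P‖ ^ 2) * ‖ξ‖ ^ 2 + 2 * deriv r (‖P‖ ^ 2) * inner ℝ P ξ ^ 2) (a b : E) :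
    radialPotential r a + r (‖a‖ ^ 2) * inner ℝ a (b - a) + c / 2 * ‖b - a‖ ^ 2 ≤
      radialPotential r b := by
  have h := second_order_lower_bound
    (fun t => hasDerivAt_radialPotential_line hr.continuousOn a (b - a) t)
    (fun t => hasDerivAt_radial_flux_line hr a (b - a) t) (fun t => hc (a + t • (b - a)) (b - a))
  simp only [zero_smul, add_zero, one_smul, add_sub_cancel] at h
  linarith

lemma radialPotential_upper_bound (hr : ContDiffOn ℝ 1 r (Ici 0)) {c : ℝ}
    (hc : ∀ P ξ : E, r (‖P‖ ^ 2) * ‖ξ‖ ^ 2 + 2 * deriv r (‖P‖ ^ 2) * inner ℝ P ξ ^ 2 ≤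
      c * ‖ξ‖ ^ 2) (a b : E) :
    radialPotential r b ≤
      radialPotential r a + r (‖a‖ ^ 2) * inner ℝ a (b - a) + c / 2 * ‖b - a‖ ^ 2 := by
  have h := second_order_lower_bound
    (fun t => (hasDerivAt_radialPotential_line hr.continuousOn a (b - a) t).neg)
    (fun t => (hasDerivAt_radial_flux_line hr a (b - a) t).neg)
    (fun t => neg_le_neg (hc (a + t • (b - a)) (b - a)))
  simp only [Pi.neg_apply, zero_smul, add_zero, one_smul, add_sub_cancel] at h
  linarith

lemma radialPotential_convex (hr : ContDiffOn ℝ 1 r (Ici 0)) {c : ℝ}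
    (hc : ∀ P ξ : E, c * ‖ξ‖ ^ 2 ≤
      r (‖P‖ ^ 2) * ‖ξ‖ ^ 2 + 2 * deriv r (‖P‖ ^ 2) * inner ℝ P ξ ^ 2) (a b : E) {s t : ℝ}
    (hs : 0 ≤ s) (ht : 0 ≤ t) (hst : s + t = 1) :
    radialPotential r (s • a + t • b) + c / 2 * (s * t) * ‖a - b‖ ^ 2 ≤
      s * radialPotential r a + t * radialPotential r b := by
  have h1 := radialPotential_lower_bound hr hc (s • a + t • b) a
  have h2 := radialPotential_lower_bound hr hc (s • a + t • b) b
  obtain rfl : s = 1 - t := by linarith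
  set P := (1 - t) • a + t • b with hP
  have ha : a - P = t • (a - b) := by rw [hP]; module
  have hb : b - P = (-(1 - t)) • (a - b) := by rw [hP]; module
  rw [ha, inner_smul_right, norm_smul, Real.norm_eq_abs, mul_pow, sq_abs] at h1
  rw [hb, inner_smul_right, norm_smul, Real.norm_eq_abs, mul_pow, sq_abs] at h2
  have h3 := add_le_add (mul_le_mul_of_nonneg_left h1 hs) (mul_le_mul_of_nonneg_left h2 ht)
  refine le_trans (le_of_eq ?_) h3
  ring

end Radial

/-! ### The cut-off density -/

lemma isOpen_admissibleRange (p : ℝ → ℝ) : IsOpen (admissibleRange p) := by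
  have h1 : IsOpen {w | ∃ ρ, 0 < ρ ∧ sonicH p ρ < w} := by
    have : {w | ∃ ρ, 0 < ρ ∧ sonicH p ρ < w} = ⋃ ρ ∈ Ioi (0 : ℝ), Ioi (sonicH p ρ) := by
      ext w
      simp
    rw [this]
    exact isOpen_biUnion fun _ _ => isOpen_Ioi
  have h2 : IsOpen {w | ∃ ρ, 0 < ρ ∧ w < enthalpy p ρ} := by
    have : {w | ∃ ρ, 0 < ρ ∧ w < enthalpy p ρ} = ⋃ ρ ∈ Ioi (0 : ℝ), Iio (enthalpy p ρ) := by
      ext w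
      simp
    rw [this]
    exact isOpen_biUnion fun _ _ => isOpen_Iio
  exact h1.inter h2

section Slices

variable {R : ℝ → ℝ → ℝ} {J : Set ℝ}

lemma contDiffOn_slice (hR : ContDiffOn ℝ 1 (fun z : ℝ × ℝ => R z.1 z.2) (Ici 0 ×ˢ J)) {w : ℝ}
    (hw : w ∈ J) : ContDiffOn ℝ 1 (fun v => R v w) (Ici 0) :=
  hR.comp (f := fun v : ℝ => (v, w)) (contDiff_id.prodMk contDiff_const).contDiffOn
    fun _ hv => ⟨hv, hw⟩

lemma continuousOn_slice_right
    (hR : ContDiffOn ℝ 1 (fun z : ℝ × ℝ => R z.1 z.2) (Ici 0 ×ˢ J)) {Λ : ℝ} (hΛ : 0 ≤ Λ) :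
    ContinuousOn (fun w => R Λ w) J :=
  hR.continuousOn.comp (f := fun w : ℝ => (Λ, w)) (by fun_prop) fun _ hw => ⟨hΛ, hw⟩

lemma potentialGv_eq (hR : ContDiffOn ℝ 1 (fun z : ℝ × ℝ => R z.1 z.2) (Ici 0 ×ˢ J)) {Λ w : ℝ}
    (hΛ : 0 < Λ) (hw : w ∈ J) : potentialGv R Λ w = 1 / 2 * R Λ w := by
  have hr := (contDiffOn_slice hR hw).continuousOn
  have hcont : ContinuousOn (fun v => R v w) (Ioi 0) := hr.mono Ioi_subset_Ici_self
  have hint : IntervalIntegrable (fun v => R v w) volume 0 Λ := by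
    refine ContinuousOn.intervalIntegrable (hr.mono ?_)
    rw [uIcc_of_le hΛ.le]
    exact Icc_subset_Ici_self
  have h := intervalIntegral.integral_hasDerivAt_right hint
    (hcont.stronglyMeasurableAtFilter isOpen_Ioi Λ hΛ) (hcont.continuousAt (Ioi_mem_nhds hΛ))
  exact (h.const_mul (1 / 2)).deriv

lemma potentialGvw_eq (hJ : IsOpen J)
    (hR : ContDiffOn ℝ 1 (fun z : ℝ × ℝ => R z.1 z.2) (Ici 0 ×ˢ J)) {Λ w : ℝ}
    (hΛ : 0 < Λ) (hw : w ∈ J) :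
    potentialGvw R Λ w = 1 / 2 * deriv (fun w => R Λ w) w := by
  have heq : (fun w' => potentialGv R Λ w') =ᶠ[𝓝 w] fun w' => 1 / 2 * R Λ w' := by
    filter_upwards [hJ.mem_nhds hw] with w' hw'
    exact potentialGv_eq hR hΛ hw'
  rw [potentialGvw, heq.deriv_eq, deriv_const_mul_field]

lemma continuousOn_deriv_slice_right (hJ : IsOpen J)
    (hR : ContDiffOn ℝ 1 (fun z : ℝ × ℝ => R z.1 z.2) (Ici 0 ×ˢ J)) {Λ : ℝ} (hΛ : 0 < Λ) :
    ContinuousOn (fun w => deriv (fun w => R Λ w) w) J := by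
  have h1 : ContDiffOn ℝ 1 (fun w => R Λ w) J :=
    hR.comp (f := fun w : ℝ => (Λ, w)) (contDiff_const.prodMk contDiff_id).contDiffOn
      fun _ hw => ⟨hΛ.le, hw⟩
  exact h1.continuousOn_deriv_of_isOpen hJ le_rfl

/-- The potential agrees, for `Λ ≥ 0` and `w ∈ J`, with a function that is Borel measurable on the
plane: integrate the extension of `R` by zero. -/
lemma exists_measurable_potentialG (hJ : IsOpen J)
    (hR : ContDiffOn ℝ 1 (fun z : ℝ × ℝ => R z.1 z.2) (Ici 0 ×ˢ J)) :
    ∃ F : ℝ × ℝ → ℝ, Measurable F ∧ ∀ Λ w, 0 ≤ Λ → w ∈ J → potentialG R Λ w = F (Λ, w) := by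
  have hm : MeasurableSet (Ici (0 : ℝ) ×ˢ J) := measurableSet_Ici.prod hJ.measurableSet
  set R' : ℝ × ℝ → ℝ := (Ici (0 : ℝ) ×ˢ J).indicator (fun z => R z.1 z.2) with hR'
  have hR'm : Measurable R' := by
    classical
    rw [hR', ← piecewise_eq_indicator]
    exact hR.continuousOn.measurable_piecewise continuousOn_const hm
  set f : (ℝ × ℝ) × ℝ → ℝ := fun z =>
    {z : (ℝ × ℝ) × ℝ | z.2 ∈ Ioc 0 z.1.1}.indicator (fun z => R' (z.2, z.1.2)) z with hf
  have hfm : Measurable f := by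
    refine Measurable.indicator (hR'm.comp (by fun_prop)) ?_
    exact (measurableSet_lt measurable_const measurable_snd).inter
      (measurableSet_le measurable_snd (by fun_prop))
  refine ⟨fun z => 1 / 2 * ∫ v, f (z, v), ?_, fun Λ w hΛ hw => ?_⟩
  · exact (hfm.stronglyMeasurable.integral_prod_right').measurable.const_mul _
  · rw [potentialG, intervalIntegral.integral_of_le hΛ, ← integral_indicator measurableSet_Ioc]
    congr 2
    ext v
    by_cases hv : v ∈ Ioc 0 Λ
    · rw [indicator_of_mem hv]
      simp only [hf]
      rw [indicator_of_mem (by exact hv), hR',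
        indicator_of_mem (show (v, w) ∈ Ici (0 : ℝ) ×ˢ J from ⟨hv.1.le, hw⟩)]
    · rw [indicator_of_notMem hv]
      simp only [hf]
      rw [indicator_of_notMem (by exact hv)]

end Slices

/-! ### Minimization of uniformly convex functions -/

/-- A uniformly convex function on a Banach space that is bounded below, and bounded above on a
ball, has a unique minimizer: minimizing sequences are Cauchy, and the function is continuous. -/
lemma exists_unique_minimizer_of_uniformly_convex {V : Type*} [NormedAddCommGroup V]
    [NormedSpace ℝ V] [CompleteSpace V] {f : V → ℝ} {m : ℝ} (hm : 0 < m)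
    (hconv : ∀ a b : V, ∀ s t : ℝ, 0 ≤ s → 0 ≤ t → s + t = 1 →
      f (s • a + t • b) + m * (s * t) * ‖a - b‖ ^ 2 ≤ s * f a + t * f b)
    {A B : ℝ} (hbelow : ∀ a, A ≤ f a) (habove : ∀ a, ‖a‖ < 1 → f a ≤ B) :
    ∃ a, (∀ b, f a ≤ f b) ∧ ∀ a', (∀ b, f a' ≤ f b) → a' = a := by
  have hmid : ∀ a b : V, f ((1 / 2 : ℝ) • a + (1 / 2 : ℝ) • b) + m / 4 * ‖a - b‖ ^ 2 ≤
      (f a + f b) / 2 := by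
    intro a b
    have := hconv a b (1 / 2) (1 / 2) (by norm_num) (by norm_num) (by norm_num)
    linarith
  have hcvx : ConvexOn ℝ univ f := by
    refine ⟨convex_univ, fun a _ b _ s t hs ht hst => ?_⟩
    have h := hconv a b s t hs ht hst
    have : 0 ≤ m * (s * t) * ‖a - b‖ ^ 2 := by positivity
    simp only [smul_eq_mul]
    linarith
  have hcont : Continuous f := by
    rw [← continuousOn_univ]
    refine ((hcvx.continuousOn_tfae isOpen_univ univ_nonempty).out 3 1).1 ?_
    refine ⟨0, mem_univ _, B, ?_⟩
    rw [eventually_map]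
    filter_upwards [Metric.ball_mem_nhds (0 : V) one_pos] with a ha
    exact habove a (mem_ball_zero_iff.1 ha)
  have hbdd : BddBelow (range f) := ⟨A, by rintro _ ⟨a, rfl⟩; exact hbelow a⟩
  set I := ⨅ a, f a with hI
  have hIle : ∀ a, I ≤ f a := fun a => ciInf_le hbdd a
  have hseq : ∀ k : ℕ, ∃ a, f a < I + 1 / ((k : ℝ) + 1) := fun k =>
    exists_lt_of_ciInf_lt (lt_add_of_pos_right _ (by positivity))
  choose u hu using hseq
  have hdist : ∀ j k N : ℕ, N ≤ j → N ≤ k →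
      dist (u j) (u k) ≤ Real.sqrt (4 / m * (1 / ((N : ℝ) + 1))) := by
    intro j k N hj hk
    have hle : ∀ i : ℕ, N ≤ i → f (u i) ≤ I + 1 / ((N : ℝ) + 1) := by
      intro i hi
      refine (hu i).le.trans ?_
      gcongr
    have h1 := hmid (u j) (u k)
    have h2 := hIle ((1 / 2 : ℝ) • u j + (1 / 2 : ℝ) • u k)
    have h3 := hle j hj
    have h4 := hle k hk
    rw [dist_eq_norm]
    refine Real.le_sqrt_of_sq_le ?_
    have h5 : m / 4 * ‖u j - u k‖ ^ 2 ≤ 1 / ((N : ℝ) + 1) := by linarith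
    calc ‖u j - u k‖ ^ 2 = 4 / m * (m / 4 * ‖u j - u k‖ ^ 2) := by field_simp
      _ ≤ _ := by gcongr
  have hcau : CauchySeq u := by
    refine cauchySeq_of_le_tendsto_0 _ hdist ?_
    have h1 : Tendsto (fun N : ℕ => 4 / m * (1 / ((N : ℝ) + 1))) atTop (𝓝 0) := by
      simpa using tendsto_one_div_add_atTop_nhds_zero_nat.const_mul (4 / m)
    have h2 := (Real.continuous_sqrt.tendsto 0).comp h1
    rwa [Real.sqrt_zero] at h2
  obtain ⟨a, ha⟩ := cauchySeq_tendsto_of_complete hcau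
  have hfa : f a ≤ I := by
    have h1 := (hcont.tendsto a).comp ha
    have h2 : Tendsto (fun k : ℕ => I + 1 / ((k : ℝ) + 1)) atTop (𝓝 I) := by
      simpa using tendsto_one_div_add_atTop_nhds_zero_nat.const_add I
    exact le_of_tendsto_of_tendsto' h1 h2 fun k => (hu k).le
  refine ⟨a, fun b => hfa.trans (hIle b), fun a' ha' => ?_⟩
  have h1 := hmid a' a
  have h2 := hIle ((1 / 2 : ℝ) • a' + (1 / 2 : ℝ) • a)
  have h3 := ha' a
  have h4 : m / 4 * ‖a' - a‖ ^ 2 ≤ 0 := by linarith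
  have h5 : ‖a' - a‖ ^ 2 ≤ 0 := by
    by_contra h
    have : 0 < m / 4 * ‖a' - a‖ ^ 2 := mul_pos (by positivity) (not_le.1 h)
    linarith
  have h6 : ‖a' - a‖ = 0 := by
    have := sq_nonneg ‖a' - a‖
    exact pow_eq_zero_iff (two_ne_zero) |>.1 (le_antisymm h5 this)
  exact sub_eq_zero.1 (norm_eq_zero.1 h6)

section Functional

/-! ### The three parts of the functional -/

section Bregman

variable {E : Type*} [NormedAddCommGroup E] [InnerProductSpace ℝ E] {r : ℝ → ℝ}

/-- The excess of `radialPotential r` at `P + ξ` over its tangent plane at `P`. -/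
def radialExcess (r : ℝ → ℝ) (P ξ : E) : ℝ :=
  radialPotential r (ξ + P) - radialPotential r P - r (‖P‖ ^ 2) * inner ℝ P ξ

lemma radialExcess_lower_bound (hr : ContDiffOn ℝ 1 r (Ici 0)) {c : ℝ}
    (hc : ∀ P ξ : E, c * ‖ξ‖ ^ 2 ≤
      r (‖P‖ ^ 2) * ‖ξ‖ ^ 2 + 2 * deriv r (‖P‖ ^ 2) * inner ℝ P ξ ^ 2) (P ξ : E) :
    c / 2 * ‖ξ‖ ^ 2 ≤ radialExcess r P ξ := by
  have h := radialPotential_lower_bound hr hc P (ξ + P)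
  rw [add_sub_cancel_right] at h
  rw [radialExcess]
  linarith

lemma radialExcess_upper_bound (hr : ContDiffOn ℝ 1 r (Ici 0)) {c : ℝ}
    (hc : ∀ P ξ : E, r (‖P‖ ^ 2) * ‖ξ‖ ^ 2 + 2 * deriv r (‖P‖ ^ 2) * inner ℝ P ξ ^ 2 ≤
      c * ‖ξ‖ ^ 2) (P ξ : E) :
    radialExcess r P ξ ≤ c / 2 * ‖ξ‖ ^ 2 := by
  have h := radialPotential_upper_bound hr hc P (ξ + P)
  rw [add_sub_cancel_right] at h
  rw [radialExcess]
  linarith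

lemma radialExcess_convex (hr : ContDiffOn ℝ 1 r (Ici 0)) {c : ℝ}
    (hc : ∀ P ξ : E, c * ‖ξ‖ ^ 2 ≤
      r (‖P‖ ^ 2) * ‖ξ‖ ^ 2 + 2 * deriv r (‖P‖ ^ 2) * inner ℝ P ξ ^ 2) (P a b : E) {s t : ℝ}
    (hs : 0 ≤ s) (ht : 0 ≤ t) (hst : s + t = 1) :
    radialExcess r P (s • a + t • b) + c / 2 * (s * t) * ‖a - b‖ ^ 2 ≤
      s * radialExcess r P a + t * radialExcess r P b := by
  have h := radialPotential_convex hr hc (a + P) (b + P) hs ht hst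
  rw [add_sub_add_right_eq_sub] at h
  have h2 : s • (a + P) + t • (b + P) = (s • a + t • b) + P := by
    obtain rfl : s = 1 - t := by linarith
    module
  rw [h2] at h
  obtain rfl : s = 1 - t := by linarith
  simp only [radialExcess, inner_add_right, inner_smul_right]
  linarith

end Bregman

variable {n : ℕ} [Fact (3 ≤ n)] {Ω : Set (EuclideanSpace ℝ (Fin n))}
  {ψ : EuclideanSpace ℝ (Fin n) → ℝ} {g : EuclideanSpace ℝ (Fin n) → EuclideanSpace ℝ (Fin n)}
  {p : ℝ → ℝ} {θ c q : ℝ} {R : ℝ → ℝ → ℝ}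

/-- The velocity `q e₁` at infinity. -/
def velocityAtInfinity (n : ℕ) [Fact (3 ≤ n)] (q : ℝ) : EuclideanSpace ℝ (Fin n) :=
  q • EuclideanSpace.single (0 : Fin n) (1 : ℝ)

lemma norm_velocityAtInfinity (hq : 0 ≤ q) : ‖velocityAtInfinity n q‖ = q := by
  simp [velocityAtInfinity, norm_smul, abs_of_nonneg hq]

lemma inner_velocityAtInfinity (q : ℝ) (ξ : EuclideanSpace ℝ (Fin n)) :
    inner ℝ (velocityAtInfinity n q) ξ = q * ξ 0 := by
  simp [velocityAtInfinity, inner_smul_left, EuclideanSpace.inner_single_left]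

lemma velocityAtInfinity_apply_zero (q : ℝ) : velocityAtInfinity n q 0 = q := by
  simp [velocityAtInfinity]

lemma energyDensity_eq
    (hR : ContDiffOn ℝ 1 (fun z : ℝ × ℝ => R z.1 z.2) (Ici 0 ×ˢ admissibleRange p)) (hq : 0 ≤ q)
    (ϕ : energySpace Ω) {x : EuclideanSpace ℝ (Fin n)} (hx : ψ x ∈ admissibleRange p) :
    energyDensity R ψ q ϕ x =
      radialExcess (fun v => R v (ψ x)) (velocityAtInfinity n q) (energyGrad ϕ x) := by
  have h1 : 2 * potentialGv R (q ^ 2) (ψ x) * q *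
      ((energyGrad ϕ x + velocityAtInfinity n q) 0 - q) =
      R (q ^ 2) (ψ x) * (q * energyGrad ϕ x 0) := by
    rw [PiLp.add_apply, velocityAtInfinity_apply_zero, add_sub_cancel_right]
    rcases hq.eq_or_lt with rfl | hq
    · simp
    · rw [potentialGv_eq hR (by positivity) hx]
      ring
  rw [radialExcess, inner_velocityAtInfinity, radialPotential, radialPotential,
    norm_velocityAtInfinity hq, ← h1]
  rfl

lemma integral_norm_energyGrad_sq (ϕ : energySpace Ω) :
    IntegrableOn (fun x => ‖energyGrad ϕ x‖ ^ 2) Ω ∧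
      ∫ x in Ω, ‖energyGrad ϕ x‖ ^ 2 = ‖ϕ.1.2.1‖ ^ 2 := by
  refine ⟨(Lp.memLp ϕ.1.2.1).integrable_norm_pow (p := 2) (by norm_num), ?_⟩
  rw [← real_inner_self_eq_norm_sq, L2.inner_def]
  refine integral_congr_ae (Eventually.of_forall fun x => ?_)
  simp [energyGrad]

lemma aestronglyMeasurable_energyDensity (hΩ : IsOpen Ω)
    (hR : ContDiffOn ℝ 1 (fun z : ℝ × ℝ => R z.1 z.2) (Ici 0 ×ˢ admissibleRange p)) (hq : 0 ≤ q)
    (hψ : ContinuousOn ψ Ω) (hψJ : ∀ x ∈ Ω, ψ x ∈ admissibleRange p) (ϕ : energySpace Ω) :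
    AEStronglyMeasurable (energyDensity R ψ q ϕ) (volume.restrict Ω) := by
  obtain ⟨F, hF, hFeq⟩ := exists_measurable_potentialG (isOpen_admissibleRange p) hR
  have hψm : AEMeasurable ψ (volume.restrict Ω) := hψ.aemeasurable hΩ.measurableSet
  have hgrad : AEMeasurable (energyGrad ϕ) (volume.restrict Ω) :=
    (Lp.aestronglyMeasurable ϕ.1.2.1).aemeasurable
  have hRψ : AEMeasurable (fun x => R (q ^ 2) (ψ x)) (volume.restrict Ω) :=
    ((continuousOn_slice_right hR (sq_nonneg q)).comp hψ hψJ).aemeasurable hΩ.measurableSet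
  have hmeas : AEMeasurable (fun x => F (‖energyGrad ϕ x + velocityAtInfinity n q‖ ^ 2, ψ x) -
      F (q ^ 2, ψ x) - R (q ^ 2) (ψ x) * inner ℝ (velocityAtInfinity n q) (energyGrad ϕ x))
      (volume.restrict Ω) := by
    refine ((hF.comp_aemeasurable (((hgrad.add_const _).norm.pow_const 2).prodMk hψm)).sub
      (hF.comp_aemeasurable (aemeasurable_const.prodMk hψm))).sub (hRψ.mul ?_)
    exact aemeasurable_const.inner hgrad
  refine (hmeas.congr ?_).aestronglyMeasurable
  filter_upwards [ae_restrict_mem hΩ.measurableSet] with x hx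
  rw [energyDensity_eq hR hq ϕ (hψJ x hx), radialExcess, norm_velocityAtInfinity hq,
    ← hFeq _ _ (by positivity) (hψJ x hx), ← hFeq _ _ (by positivity) (hψJ x hx),
    radialPotential, radialPotential, norm_velocityAtInfinity hq]
  rfl

lemma integrableOn_energyDensity (hΩ : IsOpen Ω) (hc : 0 < c) (hR : IsCutoffDensity p Ω ψ θ c R)
    (hq : 0 ≤ q) (hψ : ContinuousOn ψ Ω) (hψJ : ∀ x ∈ Ω, ψ x ∈ admissibleRange p)
    (ϕ : energySpace Ω) : IntegrableOn (energyDensity R ψ q ϕ) Ω := by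
  refine ((integral_norm_energyGrad_sq ϕ).1.const_mul (c⁻¹ / 2)).mono'
    (aestronglyMeasurable_energyDensity hΩ hR.contDiffOn hq hψ hψJ ϕ) ?_
  filter_upwards [ae_restrict_mem hΩ.measurableSet] with x hx
  have hr := contDiffOn_slice hR.contDiffOn (hψJ x hx)
  rw [energyDensity_eq hR.contDiffOn hq ϕ (hψJ x hx), Real.norm_eq_abs, abs_of_nonneg]
  · exact radialExcess_upper_bound hr (hR.elliptic_upper x hx) _ _
  · exact le_trans (by positivity) (radialExcess_lower_bound hr (hR.elliptic_lower x hx) _ _)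

lemma integral_energyDensity_bounds (hΩ : IsOpen Ω) (hc : 0 < c)
    (hR : IsCutoffDensity p Ω ψ θ c R) (hq : 0 ≤ q) (hψ : ContinuousOn ψ Ω)
    (hψJ : ∀ x ∈ Ω, ψ x ∈ admissibleRange p) (ϕ : energySpace Ω) :
    c / 2 * ‖ϕ.1.2.1‖ ^ 2 ≤ ∫ x in Ω, energyDensity R ψ q ϕ x ∧
      ∫ x in Ω, energyDensity R ψ q ϕ x ≤ c⁻¹ / 2 * ‖ϕ.1.2.1‖ ^ 2 := by
  obtain ⟨h1, h2⟩ := integral_norm_energyGrad_sq ϕ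
  have hI := integrableOn_energyDensity hΩ hc hR hq hψ hψJ ϕ
  rw [← h2, ← integral_const_mul, ← integral_const_mul]
  constructor
  · refine setIntegral_mono_on (h1.const_mul _) hI hΩ.measurableSet fun x hx => ?_
    rw [energyDensity_eq hR.contDiffOn hq ϕ (hψJ x hx)]
    exact radialExcess_lower_bound (contDiffOn_slice hR.contDiffOn (hψJ x hx))
      (hR.elliptic_lower x hx) _ _
  · refine setIntegral_mono_on hI (h1.const_mul _) hΩ.measurableSet fun x hx => ?_
    rw [energyDensity_eq hR.contDiffOn hq ϕ (hψJ x hx)]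
    exact radialExcess_upper_bound (contDiffOn_slice hR.contDiffOn (hψJ x hx))
      (hR.elliptic_upper x hx) _ _

lemma energyGrad_combination (a b : energySpace Ω) (s t : ℝ) :
    energyGrad (s • a + t • b) =ᵐ[volume.restrict Ω]
      fun x => s • energyGrad a x + t • energyGrad b x := by
  have h1 := Lp.coeFn_add (s • a.1.2.1) (t • b.1.2.1)
  filter_upwards [h1, Lp.coeFn_smul s a.1.2.1, Lp.coeFn_smul t b.1.2.1] with x h1 h2 h3
  rw [Pi.add_apply, h2, h3] at h1
  exact h1

lemma energyVal_combination (a b : energySpace Ω) (s t : ℝ) :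
    energyVal (s • a + t • b) =ᵐ[volume.restrict Ω]
      fun x => s * energyVal a x + t * energyVal b x := by
  have h1 := Lp.coeFn_add (s • a.1.1) (t • b.1.1)
  filter_upwards [h1, Lp.coeFn_smul s a.1.1, Lp.coeFn_smul t b.1.1] with x h1 h2 h3
  rw [Pi.add_apply, h2, h3] at h1
  exact h1

lemma energyTrace_combination (a b : energySpace Ω) (s t : ℝ) :
    energyTrace (s • a + t • b) =ᵐ[surfaceMeasure Ω]
      fun x => s * energyTrace a x + t * energyTrace b x := by
  have h1 := Lp.coeFn_add (s • a.1.2.2) (t • b.1.2.2)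
  filter_upwards [h1, Lp.coeFn_smul s a.1.2.2, Lp.coeFn_smul t b.1.2.2] with x h1 h2 h3
  rw [Pi.add_apply, h2, h3] at h1
  exact h1

lemma integral_energyDensity_convex (hΩ : IsOpen Ω) (hc : 0 < c)
    (hR : IsCutoffDensity p Ω ψ θ c R) (hq : 0 ≤ q) (hψ : ContinuousOn ψ Ω)
    (hψJ : ∀ x ∈ Ω, ψ x ∈ admissibleRange p) (a b : energySpace Ω) {s t : ℝ}
    (hs : 0 ≤ s) (ht : 0 ≤ t) (hst : s + t = 1) :
    (∫ x in Ω, energyDensity R ψ q (s • a + t • b) x) +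
        c / 2 * (s * t) * ‖a.1.2.1 - b.1.2.1‖ ^ 2 ≤
      s * (∫ x in Ω, energyDensity R ψ q a x) + t * ∫ x in Ω, energyDensity R ψ q b x := by
  obtain ⟨h1, h2⟩ := integral_norm_energyGrad_sq (a - b)
  have hI := integrableOn_energyDensity hΩ hc hR hq hψ hψJ
  have h3 : ‖a.1.2.1 - b.1.2.1‖ ^ 2 = ∫ x in Ω, ‖energyGrad (a - b) x‖ ^ 2 := h2.symm
  rw [h3, ← integral_const_mul, ← integral_const_mul, ← integral_const_mul,
    ← integral_add (hI _) (h1.const_mul _), ← integral_add ((hI a).const_mul s)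
    ((hI b).const_mul t)]
  refine integral_mono_ae ((hI _).add (h1.const_mul _)) (((hI a).const_mul s).add
    ((hI b).const_mul t)) ?_
  have hsub : energyGrad (a - b) =ᵐ[volume.restrict Ω] energyGrad a - energyGrad b :=
    Lp.coeFn_sub a.1.2.1 b.1.2.1
  filter_upwards [ae_restrict_mem hΩ.measurableSet, energyGrad_combination a b s t, hsub]
    with x hx hcomb hsub
  simp only [energyDensity_eq hR.contDiffOn hq _ (hψJ x hx), hcomb, hsub]
  exact radialExcess_convex (contDiffOn_slice hR.contDiffOn (hψJ x hx))
    (hR.elliptic_lower x hx) _ _ _ hs ht hst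

/-- A direction orthogonal to the velocity shows that the cut-off density itself lies between the
ellipticity constants. -/
lemma IsCutoffDensity.bounds (hR : IsCutoffDensity p Ω ψ θ c R) (hq : 0 ≤ q)
    {x : EuclideanSpace ℝ (Fin n)} (hx : x ∈ Ω) :
    c ≤ R (q ^ 2) (ψ x) ∧ R (q ^ 2) (ψ x) ≤ c⁻¹ := by
  have hn : 3 ≤ n := Fact.out
  let i : Fin n := ⟨1, by omega⟩
  have hi : (0 : Fin n) ≠ i := by
    intro h
    have := congrArg Fin.val h
    simp [i] at this
  have hin : inner ℝ (velocityAtInfinity n q) (EuclideanSpace.single i (1 : ℝ)) = 0 := by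
    rw [inner_velocityAtInfinity]
    simp [hi]
  have h1 := hR.elliptic_lower x hx (velocityAtInfinity n q) (EuclideanSpace.single i (1 : ℝ))
  have h2 := hR.elliptic_upper x hx (velocityAtInfinity n q) (EuclideanSpace.single i (1 : ℝ))
  rw [hin, norm_velocityAtInfinity hq] at h1 h2
  simp at h1 h2
  exact ⟨h1, h2⟩

lemma integrable_and_abs_integral_mul_le {X : Type*} [MeasurableSpace X] {μ : Measure X}
    {a f : X → ℝ} {K : ℝ} (ha : AEStronglyMeasurable a μ) (haK : ∀ᵐ x ∂μ, |a x| ≤ K)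
    (hf : Integrable f μ) :
    Integrable (fun x => a x * f x) μ ∧ |∫ x, a x * f x ∂μ| ≤ K * (eLpNorm f 1 μ).toReal := by
  have hint : Integrable (fun x => a x * f x) μ := hf.bdd_mul ha haK
  refine ⟨hint, ?_⟩
  calc |∫ x, a x * f x ∂μ| ≤ ∫ x, |a x * f x| ∂μ := abs_integral_le_integral_abs
    _ ≤ ∫ x, K * ‖f x‖ ∂μ := by
        refine integral_mono_ae hint.abs (hf.norm.const_mul K) ?_
        filter_upwards [haK] with x hx
        rw [abs_mul, Real.norm_eq_abs]
        gcongr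
    _ = K * (eLpNorm f 1 μ).toReal := by
        rw [integral_const_mul, integral_norm_eq_lintegral_enorm hf.1,
          eLpNorm_one_eq_lintegral_enorm]

lemma force_term (hΩ : IsOpen Ω) (hc : 0 < c) (hR : IsCutoffDensity p Ω ψ θ c R)
    (hq : 0 ≤ q) (hψ : ContinuousOn ψ Ω) (hψJ : ∀ x ∈ Ω, ψ x ∈ admissibleRange p)
    (hg : MemLp (fun x => g x 0) (ENNReal.ofReal (2 * n / (n + 2))) (volume.restrict Ω))
    (ϕ : energySpace Ω) :
    IntegrableOn (forceDensity R ψ g q ϕ) Ω ∧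
      |∫ x in Ω, forceDensity R ψ g q ϕ x| ≤ c⁻¹ *
        ((eLpNorm (fun x => g x 0) (ENNReal.ofReal (2 * n / (n + 2))) (volume.restrict Ω)).toReal *
          ‖ϕ.1.1‖) := by
  have hn : 3 ≤ n := Fact.out
  have hn' : (3 : ℝ) ≤ n := by exact_mod_cast hn
  have hH : ENNReal.HolderConjugate (ENNReal.ofReal (2 * n / (n + 2))) (sobolevExponent n) := by
    refine ⟨?_⟩
    rw [sobolevExponent, ← ENNReal.ofReal_inv_of_pos (by positivity),
      ← ENNReal.ofReal_inv_of_pos (div_pos (by positivity) (by linarith)),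
      ← ENNReal.ofReal_add (by positivity)
        (inv_nonneg.2 (div_nonneg (by positivity) (by linarith))), inv_one, ← ENNReal.ofReal_one]
    congr 1
    field_simp
    ring
  have hval : MemLp (energyVal ϕ) (sobolevExponent n) (volume.restrict Ω) := Lp.memLp ϕ.1.1
  have hprod : Integrable (fun x => g x 0 * energyVal ϕ x) (volume.restrict Ω) :=
    hg.integrable_mul hval
  have hcoef : ∀ x ∈ Ω, 2 * potentialGvw R (q ^ 2) (ψ x) * q =
      if q = 0 then 0 else deriv (fun w => R (q ^ 2) w) (ψ x) * q := by
    intro x hx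
    split_ifs with h0
    · simp [h0]
    · have hq0 : 0 < q := lt_of_le_of_ne hq (Ne.symm h0)
      rw [potentialGvw_eq (isOpen_admissibleRange p) hR.contDiffOn (by positivity) (hψJ x hx)]
      ring
  have hmeas : AEStronglyMeasurable (fun x => 2 * potentialGvw R (q ^ 2) (ψ x) * q)
      (volume.restrict Ω) := by
    have hcont : ContinuousOn (fun x => 2 * potentialGvw R (q ^ 2) (ψ x) * q) Ω := by
      refine ContinuousOn.congr ?_ hcoef
      by_cases h0 : q = 0
      · simp only [if_pos h0]
        exact continuousOn_const
      · have hq0 : 0 < q := lt_of_le_of_ne hq (Ne.symm h0)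
        simp only [if_neg h0]
        exact ((continuousOn_deriv_slice_right (isOpen_admissibleRange p) hR.contDiffOn
          (by positivity)).comp hψ hψJ).mul continuousOn_const
    exact hcont.aestronglyMeasurable hΩ.measurableSet
  have hbound : ∀ᵐ x ∂(volume.restrict Ω), |2 * potentialGvw R (q ^ 2) (ψ x) * q| ≤ c⁻¹ := by
    filter_upwards [ae_restrict_mem hΩ.measurableSet] with x hx
    rw [hcoef x hx]
    split_ifs
    · simpa using hc.le
    · have h := hR.lower_order x hx (velocityAtInfinity n q)
      rw [norm_velocityAtInfinity hq] at h
      rwa [abs_mul, abs_of_nonneg hq]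
  obtain ⟨h1, h2⟩ := integrable_and_abs_integral_mul_le hmeas hbound hprod
  have heq : forceDensity R ψ g q ϕ =
      fun x => 2 * potentialGvw R (q ^ 2) (ψ x) * q * (g x 0 * energyVal ϕ x) := by
    ext x
    rw [forceDensity]
    ring
  rw [heq]
  refine ⟨h1, h2.trans (mul_le_mul_of_nonneg_left ?_ (by positivity))⟩
  rw [Lp.norm_def, ← ENNReal.toReal_mul]
  refine ENNReal.toReal_mono (ENNReal.mul_ne_top hg.2.ne hval.2.ne) ?_
  exact eLpNorm_smul_le_mul_eLpNorm (f := energyVal ϕ) (φ := fun x => g x 0) (r := 1) hval.1 hg.1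

lemma surface_term {α : ℝ≥0} (hΩ : IsExteriorDomain α Ω) (hc : 0 < c)
    (hR : IsCutoffDensity p Ω ψ θ c R) (hq : 0 ≤ q) (hψ : ContinuousOn ψ (closure Ω))
    (hψJ : ∀ x ∈ closure Ω, ψ x ∈ admissibleRange p) (ϕ : energySpace Ω) :
    Integrable (surfaceDensity R ψ q ϕ) (surfaceMeasure Ω) ∧
      |∫ x, surfaceDensity R ψ q ϕ x ∂(surfaceMeasure Ω)| ≤ c⁻¹ * q * ‖ϕ.1.2.2‖ := by
  have hfm : MeasurableSet (frontier Ω) := isClosed_frontier.measurableSet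
  have hsub : frontier Ω ⊆ closure Ω := frontier_subset_closure
  have hRc : ContinuousOn (fun x => R (q ^ 2) (ψ x)) (closure Ω) :=
    (continuousOn_slice_right hR.contDiffOn (sq_nonneg q)).comp hψ hψJ
  have hRle : ∀ x ∈ closure Ω, |R (q ^ 2) (ψ x)| ≤ c⁻¹ := fun x hx =>
    le_on_closure (f := fun x => |R (q ^ 2) (ψ x)|) (fun y hy => by
      have h := hR.bounds hq hy
      rw [abs_of_nonneg (hc.le.trans h.1)]
      exact h.2) hRc.abs continuousOn_const hx
  have hcoef : ∀ x ∈ frontier Ω, 2 * potentialGv R (q ^ 2) (ψ x) * q * outerNormal Ω x 0 =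
      R (q ^ 2) (ψ x) * q * outerNormal Ω x 0 := by
    intro x hx
    rcases hq.eq_or_lt with rfl | hq0
    · simp
    · rw [potentialGv_eq hR.contDiffOn (by positivity) (hψJ x (hsub hx))]
      ring
  have hmeas : AEStronglyMeasurable
      (fun x => 2 * potentialGv R (q ^ 2) (ψ x) * q * outerNormal Ω x 0) (surfaceMeasure Ω) := by
    have hcont : ContinuousOn
        (fun x => 2 * potentialGv R (q ^ 2) (ψ x) * q * outerNormal Ω x 0) (frontier Ω) := by
      refine ContinuousOn.congr ?_ hcoef
      refine ((hRc.mono hsub).mul continuousOn_const).mul ?_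
      exact (EuclideanSpace.proj (𝕜 := ℝ) (0 : Fin n)).continuous.comp_continuousOn
        (continuousOn_outerNormal hΩ.hasC1GraphBoundary)
    exact hcont.aestronglyMeasurable hfm
  have hbound : ∀ᵐ x ∂(surfaceMeasure Ω),
      |2 * potentialGv R (q ^ 2) (ψ x) * q * outerNormal Ω x 0| ≤ c⁻¹ * q := by
    filter_upwards [ae_restrict_mem (μ := Measure.euclideanHausdorffMeasure (n - 1)) hfm] with x hx
    rw [hcoef x hx, abs_mul, abs_mul, abs_of_nonneg hq]
    have h1 : |outerNormal Ω x 0| ≤ 1 := by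
      have := PiLp.norm_apply_le (outerNormal Ω x) 0
      rwa [norm_outerNormal hΩ.hasC1GraphBoundary hx] at this
    calc |R (q ^ 2) (ψ x)| * q * |outerNormal Ω x 0| ≤ c⁻¹ * q * 1 := by
          gcongr
          exact hRle x (hsub hx)
      _ = c⁻¹ * q := mul_one _
  have htr : Integrable (energyTrace ϕ) (surfaceMeasure Ω) := L1.integrable_coeFn ϕ.1.2.2
  obtain ⟨h1, h2⟩ := integrable_and_abs_integral_mul_le hmeas hbound htr
  have heq : surfaceDensity R ψ q ϕ =
      fun x => 2 * potentialGv R (q ^ 2) (ψ x) * q * outerNormal Ω x 0 * energyTrace ϕ x := by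
    ext x
    rw [surfaceDensity]
    ring
  rw [heq]
  refine ⟨h1, h2.trans (le_of_eq ?_)⟩
  rw [Lp.norm_def]
  rfl

lemma integral_forceDensity_combination {a b : energySpace Ω}
    (ha : IntegrableOn (forceDensity R ψ g q a) Ω) (hb : IntegrableOn (forceDensity R ψ g q b) Ω)
    (s t : ℝ) : ∫ x in Ω, forceDensity R ψ g q (s • a + t • b) x =
      s * (∫ x in Ω, forceDensity R ψ g q a x) + t * ∫ x in Ω, forceDensity R ψ g q b x := by
  rw [← integral_const_mul, ← integral_const_mul, ← integral_add (ha.const_mul s) (hb.const_mul t)]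
  refine integral_congr_ae ?_
  filter_upwards [energyVal_combination a b s t] with x hx
  simp only [forceDensity, hx]
  ring

lemma integral_surfaceDensity_combination {a b : energySpace Ω}
    (ha : Integrable (surfaceDensity R ψ q a) (surfaceMeasure Ω))
    (hb : Integrable (surfaceDensity R ψ q b) (surfaceMeasure Ω)) (s t : ℝ) :
    ∫ x, surfaceDensity R ψ q (s • a + t • b) x ∂(surfaceMeasure Ω) =
      s * (∫ x, surfaceDensity R ψ q a x ∂(surfaceMeasure Ω)) +
        t * ∫ x, surfaceDensity R ψ q b x ∂(surfaceMeasure Ω) := by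
  rw [← integral_const_mul, ← integral_const_mul, ← integral_add (ha.const_mul s) (hb.const_mul t)]
  refine integral_congr_ae ?_
  filter_upwards [energyTrace_combination a b s t] with x hx
  simp only [surfaceDensity, hx]
  ring

end Functional

instance completeSpace_energySpace {n : ℕ} [Fact (3 ≤ n)] (Ω : Set (EuclideanSpace ℝ (Fin n))) :
    CompleteSpace (energySpace Ω) :=
  (smoothEnergySpace Ω).isClosed_topologicalClosure.completeSpace_coe

end

theorem theorem4p3 {n : ℕ} [Fact (3 ≤ n)]
    (α : ℝ≥0) (hα₀ : 0 < α) (hα₁ : α < 1)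
    (Ω : Set (EuclideanSpace ℝ (Fin n))) (hΩ : IsExteriorDomain α Ω)
    (ψ : EuclideanSpace ℝ (Fin n) → ℝ) (g : EuclideanSpace ℝ (Fin n) → EuclideanSpace ℝ (Fin n))
    (hψ_cont : ContinuousOn ψ (closure Ω)) (hψ_bdd : ∃ M, ∀ x ∈ Ω, |ψ x| ≤ M)
    (hψ_grad : IsWeakGradient Ω ψ g)
    (hψ_one : MemLp (fun x => g x 0) (ENNReal.ofReal (2 * n / (n + 2))) (volume.restrict Ω))
    (β s : ℝ) (hs : (n : ℝ) < s) (hβ : 1 - n / s < β)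
    (hψ_decay : MemLp (fun x => ‖x‖ ^ β • g x) (ENNReal.ofReal s) (volume.restrict Ω))
    (q : ℝ) (hq : 0 ≤ q) (c : ℝ) (hc : 0 < c) :
    ∃ C : ℝ, ∀ (p : ℝ → ℝ), IsPressureLaw p → (∀ x ∈ closure Ω, ψ x ∈ admissibleRange p) →
      ∀ (θ : ℝ), 0 < θ → θ < 1 / 2 →
      ∀ (R : ℝ → ℝ → ℝ), IsCutoffDensity p Ω ψ θ c R →
      ∀ (ε : ℝ), ε = 1 ∨ ε = -1 →
        (∀ ϕ : energySpace Ω,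
          IntegrableOn (energyDensity R ψ q ϕ) Ω ∧ IntegrableOn (forceDensity R ψ g q ϕ) Ω ∧
            Integrable (surfaceDensity R ψ q ϕ) (surfaceMeasure Ω)) ∧
        ∃ ϕ : energySpace Ω,
          (∀ η : energySpace Ω, energyFunctional ε R ψ g q ϕ ≤ energyFunctional ε R ψ g q η) ∧
          (∀ ϕ' : energySpace Ω,
            (∀ η : energySpace Ω, energyFunctional ε R ψ g q ϕ' ≤ energyFunctional ε R ψ g q η) →
              ϕ' = ϕ) ∧
          IntegrableOn (fun x => ‖energyGrad ϕ x‖ ^ 2) Ω ∧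
          ∫ x in Ω, ‖energyGrad ϕ x‖ ^ 2 ≤ C := by
  obtain ⟨C, hC0, hC⟩ := exists_norm_le_mul_norm_grad hΩ
  set N : ℝ := (eLpNorm (fun x => g x 0) (ENNReal.ofReal (2 * n / (n + 2)))
    (volume.restrict Ω)).toReal with hN
  have hN0 : 0 ≤ N := ENNReal.toReal_nonneg
  -- the norm of the linear part of the functional with respect to the energy norm
  set L : ℝ := c⁻¹ * (N * C) + c⁻¹ * q * C with hL
  have hL0 : 0 ≤ L := by positivity
  refine ⟨(2 * L / c) ^ 2, ?_⟩
  intro p _ hψJ θ _ _ R hR ε hε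
  have hψΩ : ContinuousOn ψ Ω := hψ_cont.mono subset_closure
  have hψJΩ : ∀ x ∈ Ω, ψ x ∈ admissibleRange p := fun x hx => hψJ x (subset_closure hx)
  have hE := integrableOn_energyDensity hΩ.isOpen hc hR hq hψΩ hψJΩ
  have hF := force_term (g := g) hΩ.isOpen hc hR hq hψΩ hψJΩ hψ_one
  have hS := surface_term hΩ hc hR hq hψ_cont hψJ
  refine ⟨fun ϕ => ⟨hE ϕ, (hF ϕ).1, (hS ϕ).1⟩, ?_⟩
  set I : energySpace Ω → ℝ := energyFunctional ε R ψ g q with hI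
  have hε1 : |ε| = 1 := by rcases hε with rfl | rfl <;> simp
  have hlin : ∀ ϕ : energySpace Ω, |ε * ((∫ x in Ω, forceDensity R ψ g q ϕ x)
      - ∫ x, surfaceDensity R ψ q ϕ x ∂(surfaceMeasure Ω))| ≤ L * ‖ϕ.1.2.1‖ := by
    intro ϕ
    obtain ⟨h1, h2⟩ := hC ϕ.1 ϕ.2
    rw [abs_mul, hε1, one_mul]
    calc _ ≤ c⁻¹ * (N * ‖ϕ.1.1‖) + c⁻¹ * q * ‖ϕ.1.2.2‖ :=
          (abs_sub _ _).trans (add_le_add (hF ϕ).2 (hS ϕ).2)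
      _ ≤ c⁻¹ * (N * (C * ‖ϕ.1.2.1‖)) + c⁻¹ * q * (C * ‖ϕ.1.2.1‖) := by gcongr
      _ = L * ‖ϕ.1.2.1‖ := by rw [hL]; ring
  have hlow : ∀ ϕ : energySpace Ω, c / 2 * ‖ϕ.1.2.1‖ ^ 2 - L * ‖ϕ.1.2.1‖ ≤ I ϕ := by
    intro ϕ
    have h1 := (integral_energyDensity_bounds hΩ.isOpen hc hR hq hψΩ hψJΩ ϕ).1
    have h2 := (abs_le.1 (hlin ϕ)).1
    simp only [hI, energyFunctional]
    linarith
  have hup : ∀ ϕ : energySpace Ω, I ϕ ≤ c⁻¹ / 2 * ‖ϕ.1.2.1‖ ^ 2 + L * ‖ϕ.1.2.1‖ := by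
    intro ϕ
    have h1 := (integral_energyDensity_bounds hΩ.isOpen hc hR hq hψΩ hψJΩ ϕ).2
    have h2 := (abs_le.1 (hlin ϕ)).2
    simp only [hI, energyFunctional]
    linarith
  have hnorm : ∀ ϕ : energySpace Ω, ‖ϕ‖ ≤ (C + 1) * ‖ϕ.1.2.1‖ := by
    intro ϕ
    obtain ⟨h1, h2⟩ := hC ϕ.1 ϕ.2
    have h0 := norm_nonneg ϕ.1.2.1
    have hCg : 0 ≤ C * ‖ϕ.1.2.1‖ := by positivity
    change max ‖ϕ.1.1‖ (max ‖ϕ.1.2.1‖ ‖ϕ.1.2.2‖) ≤ _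
    refine max_le ?_ (max_le ?_ ?_) <;> linarith
  have hconv : ∀ a b : energySpace Ω, ∀ s t : ℝ, 0 ≤ s → 0 ≤ t → s + t = 1 →
      I (s • a + t • b) + c / 2 / (C + 1) ^ 2 * (s * t) * ‖a - b‖ ^ 2 ≤ s * I a + t * I b := by
    intro a b s t hs ht hst
    have h1 := integral_energyDensity_convex hΩ.isOpen hc hR hq hψΩ hψJΩ a b hs ht hst
    have h2 := integral_forceDensity_combination (hF a).1 (hF b).1 s t
    have h3 := integral_surfaceDensity_combination (hS a).1 (hS b).1 s t
    have h4 : c / 2 / (C + 1) ^ 2 * (s * t) * ‖a - b‖ ^ 2 ≤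
        c / 2 * (s * t) * ‖a.1.2.1 - b.1.2.1‖ ^ 2 := by
      have h5 := hnorm (a - b)
      calc c / 2 / (C + 1) ^ 2 * (s * t) * ‖a - b‖ ^ 2
          ≤ c / 2 / (C + 1) ^ 2 * (s * t) * ((C + 1) * ‖a.1.2.1 - b.1.2.1‖) ^ 2 := by
            gcongr
            exact h5
        _ = _ := by
            have : C + 1 ≠ 0 := by positivity
            field_simp
    simp only [hI, energyFunctional, h2, h3]
    linarith
  obtain ⟨ϕ, hmin, huniq⟩ := exists_unique_minimizer_of_uniformly_convex
    (m := c / 2 / (C + 1) ^ 2) (by positivity) hconv (A := -(L ^ 2 / (2 * c)))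
    (B := c⁻¹ / 2 + L)
    (fun ϕ => by
      refine le_trans ?_ (hlow ϕ)
      -- complete the square
      have h1 : c / 2 * ‖ϕ.1.2.1‖ ^ 2 - L * ‖ϕ.1.2.1‖ + L ^ 2 / (2 * c) =
          c / 2 * (‖ϕ.1.2.1‖ - L / c) ^ 2 := by
        field_simp
        ring
      have h2 : 0 ≤ c / 2 * (‖ϕ.1.2.1‖ - L / c) ^ 2 := by positivity
      linarith)
    (fun ϕ hϕ => by
      have h1 : ‖ϕ.1.2.1‖ ≤ 1 :=
        ((norm_fst_le ϕ.1.2).trans ((norm_snd_le ϕ.1).trans hϕ.le))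
      have h2 := norm_nonneg ϕ.1.2.1
      refine (hup ϕ).trans ?_
      calc c⁻¹ / 2 * ‖ϕ.1.2.1‖ ^ 2 + L * ‖ϕ.1.2.1‖ ≤ c⁻¹ / 2 * 1 ^ 2 + L * 1 := by gcongr
        _ = _ := by ring)
  obtain ⟨hint, hsq⟩ := integral_norm_energyGrad_sq ϕ
  refine ⟨ϕ, hmin, huniq, hint, ?_⟩
  rw [hsq]
  -- compare with the value of the functional at `0`
  have h0 : I 0 ≤ 0 := by
    have h := hup 0
    have hz : ‖(0 : energySpace Ω).1.2.1‖ = 0 := norm_zero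
    rw [hz] at h
    simpa using h
  have h1 : c / 2 * ‖ϕ.1.2.1‖ ^ 2 ≤ L * ‖ϕ.1.2.1‖ := by
    have := (hlow ϕ).trans ((hmin 0).trans h0)
    linarith
  have h2 : ‖ϕ.1.2.1‖ ≤ 2 * L / c := by
    rw [le_div_iff₀ hc]
    rcases (norm_nonneg ϕ.1.2.1).eq_or_lt with h | h
    · rw [← h]
      linarith
    · have h3 : (c / 2 * ‖ϕ.1.2.1‖) * ‖ϕ.1.2.1‖ ≤ L * ‖ϕ.1.2.1‖ := by
        rw [mul_assoc, ← sq]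
        exact h1
      have h4 := le_of_mul_le_mul_right h3 h
      linarith
  gcongr
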